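/- Let $\xi>0$ and let $S=(0,\infty)\times S^1$ be the cone with metric $ds^2=dr^2+\xi^2r^2d\varphi^2$ ($\varphi$ mod $2\pi$), whose cone angle is $2\pi\xi$. A central potential is a $C^\infty$ function $V=V(r)$ on $(0,\infty)$; a point moves on $S$ with Lagrangian $\tfrac12(\dot r^2+\xi^2r^2\dot\varphi^2)-V(r)$, and $K=\xi^2r^2\dot\varphi$ is its angular momentum. A trajectory (and its orbit, the image in $S$) is called bounded if it is defined for all $t\in\mathbb R$ and stays in some $[r_1,r_2]\times S^1\subset S$, nonsingular if $K\ne0$, circular if its orbit is a circle $\{r_0\}\times S^1$, and closed if it is periodic in $S$. A circular orbit $\{r_0\}\times S^1$ with angular momentum $K_0\neq 0$ is strongly stable if $V(r)+K_0^2/(2\xi^2r^2)$ has a nondegenerate local minimum at $r_0$, and orbitally stable if its phase orbit is (Lyapunov) orbitally stable within the level set $\{K=K_0\}$ of the phase space. Consider the following conditions on $V$. * $(\exists)$: there is a nonsingular bounded noncircular orbit. * $(\forall)$: every nonsingular bounded orbit is closed. * $(\exists)^{\rm loc}$: there is a strongly stable circular orbit. * $(\forall)^{\rm loc}$: for every strongly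 stable circular orbit $\{r_0\}\times S^1$ with angular momentum $K_0$ there is $\varepsilon>0$ such that every nonsingular bounded orbit in $[r_0-\varepsilon,r_0+\varepsilon]\times S^1$ with angular momentum in $(K_0-\varepsilon,K_0+\varepsilon)$ is closed. The potential $V$ is called * closing if $(\exists)$ and $(\forall)$ hold; * locally closing if $(\exists)^{\rm loc}$ and $(\forall)^{\rm loc}$ hold; * semilocally closing if $(\forall)^{\rm loc}$ holds and there is a nonsingular bounded noncircular orbit $\gamma$, with angular momentum $\hat K$, such that every nonsingular bounded orbit with angular momentum $\hat K$ in $[\inf r|_\gamma,\sup r|_\gamma]\times S^1$ is closed; * strongly closing if every circle $\{r\}\times S^1$ is a strongly stable circular orbit and $(\forall)^{\rm loc}$ holds; * weakly closing if every circle $\{r\}\times S^1$ is an orbitally stable circular orbit and the analogue of $(\forall)^{\rm loc}$ for all orbitally stable circular orbits holds. **Theorem.** If $\xi$ is irrational, then no central potential on $S$ is closing, locally closing, semilocally closing, strongly closing or weakly closing. If $\xi$ is rational, then for each of these five notions there are exactly two such potentials up to additive and multiplicative constants: the potentials with the property are precisely $$V_i(r)=(-1)^i\,\frac{A\,r^{\,i^2-2}}{i}+B,\qquad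 i\in\{1,2\},\ A>0,\ B\in\mathbb R,$$ and no $V_1$ is of the form $aV_2+b$ with $a,b\in\mathbb R$. In the field of $V_i$ every nonsingular noncircular bounded orbit is given by a periodic function $r=r(\varphi)$, $\varphi\in\mathbb R$, with minimal positive period $\Phi_i=2\pi/(i\xi)$. The vertex $\{0\}\times S^1$ is an attracting center for each $V_i$, that is, $\lim_{r\to0+}V_i(r)=\inf_{r>0}V_i(r)\in[-\infty,\infty)$. -/

import Mathlib

open Set Filter Topology
open scoped ContDiff

/-!
Motion of a point on an abstract surface of revolution `I × S¹` with metric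
`dr² + f(r)² dφ²` (`I` an open interval of the real line, `S¹ = ℝ / 2πℤ`), in the field of a
central potential `V = V(r)`.  Curves on the surface are given by the function `r` and a
real-valued lift of the angle `φ`; points of the surface are pairs in `ℝ × Real.Angle`.
-/

namespace Revolution

/-- `(r, φ)` solves, at all times of the open set `J`, the equations of motion on the surface,
i.e. the Euler-Lagrange equations of `(ṙ² + f(r)² φ̇²) / 2 - V(r)`:
`r̈ = f(r) f'(r) φ̇² - V'(r)` and `(f(r)² φ̇)˙ = 0`. -/
def IsMotionOn (I : Set ℝ) (f V : ℝ → ℝ) (J : Set ℝ) (r φ : ℝ → ℝ) : Prop :=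
  ∀ t ∈ J, r t ∈ I ∧ DifferentiableAt ℝ r t ∧ DifferentiableAt ℝ φ t ∧
    HasDerivAt (deriv r) (f (r t) * deriv f (r t) * (deriv φ t) ^ 2 - deriv V (r t)) t ∧
    HasDerivAt (fun s => f (r s) ^ 2 * deriv φ s) 0 t

/-- The integral of angular momentum takes the value `K` along the curve, at the times in `J`. -/
def HasMomentum (f : ℝ → ℝ) (J : Set ℝ) (r φ : ℝ → ℝ) (K : ℝ) : Prop :=
  ∀ t ∈ J, f (r t) ^ 2 * deriv φ t = K

/-- The orbit (image on the surface) of a curve defined on the whole time axis. -/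
def orbit (r φ : ℝ → ℝ) : Set (ℝ × Real.Angle) :=
  range fun t => (r t, (φ t : Real.Angle))

/-- The point `((r, φ), (ṙ, φ̇))` of the tangent bundle at time `t`. -/
noncomputable def phase (r φ : ℝ → ℝ) (t : ℝ) : (ℝ × Real.Angle) × (ℝ × ℝ) :=
  ((r t, (φ t : Real.Angle)), (deriv r t, deriv φ t))

/-- The phase orbit of a curve defined on the whole time axis. -/
def phaseOrbit (r φ : ℝ → ℝ) : Set ((ℝ × Real.Angle) × (ℝ × ℝ)) :=
  range (phase r φ)

/-- The orbit is the circle `{r₀} × S¹`, an orbit of the group of rotations. -/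
def OrbitIsCircle (r φ : ℝ → ℝ) (r₀ : ℝ) : Prop :=
  orbit r φ = {r₀} ×ˢ (univ : Set Real.Angle)

/-- The orbit is circular. -/
def OrbitIsCircular (r φ : ℝ → ℝ) : Prop :=
  ∃ r₀, OrbitIsCircle r φ r₀

/-- The orbit is closed: the point returns periodically to the same position. -/
def OrbitIsClosed (r φ : ℝ → ℝ) : Prop :=
  ∃ T : ℝ, 0 < T ∧ ∀ t, r (t + T) = r t ∧ (φ (t + T) : Real.Angle) = (φ t : Real.Angle)

/-- A bounded trajectory: it is defined on the whole time axis, and it stays in a compact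
annulus `[r₁, r₂] × S¹` contained in the surface. -/
def IsBoundedTrajectory (I : Set ℝ) (f V : ℝ → ℝ) (r φ : ℝ → ℝ) : Prop :=
  IsMotionOn I f V univ r φ ∧ ∃ r₁ r₂ : ℝ, Icc r₁ r₂ ⊆ I ∧ ∀ t, r t ∈ Icc r₁ r₂

/-- A nonsingular bounded trajectory with value `K ≠ 0` of the angular momentum. -/
def IsNonsingularBounded (I : Set ℝ) (f V : ℝ → ℝ) (r φ : ℝ → ℝ) (K : ℝ) : Prop :=
  IsBoundedTrajectory I f V r φ ∧ HasMomentum f univ r φ K ∧ K ≠ 0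

/-- `(r, φ)` is a circular trajectory with orbit `{r₀} × S¹` and angular momentum `K₀`. -/
def IsCircularTrajectory (I : Set ℝ) (f V : ℝ → ℝ) (r φ : ℝ → ℝ) (r₀ K₀ : ℝ) : Prop :=
  IsMotionOn I f V univ r φ ∧ HasMomentum f univ r φ K₀ ∧ OrbitIsCircle r φ r₀

/-- The effective potential `V(r) + K² / (2 f(r)²)`. -/
noncomputable def effectivePotential (f V : ℝ → ℝ) (K : ℝ) (r : ℝ) : ℝ :=
  V r + K ^ 2 / (2 * f r ^ 2)

/-- `{r₀} × S¹` is a strongly stable circular orbit, with angular momentum `K₀ ≠ 0`: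
the effective potential has a nondegenerate local minimum on it. -/
def IsStronglyStable (I : Set ℝ) (f V : ℝ → ℝ) (r₀ K₀ : ℝ) : Prop :=
  (∃ r φ, IsCircularTrajectory I f V r φ r₀ K₀) ∧ K₀ ≠ 0 ∧
    IsLocalMin (effectivePotential f V K₀) r₀ ∧
    iteratedDeriv 2 (effectivePotential f V K₀) r₀ ≠ 0

/-- Orbital (Lyapunov) stability of the phase orbit of `(r, φ)` for the restriction of the system
to the level set `{K = K₀}` of the angular momentum: solutions in this level set that start close
to the phase orbit stay close to it for all later times at which they are defined. -/
def IsOrbitallyStableTrajectory (I : Set ℝ) (f V : ℝ → ℝ) (r φ : ℝ → ℝ) (K₀ : ℝ) : Prop :=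
  ∀ U ∈ 𝓝ˢ (phaseOrbit r φ), ∃ W ∈ 𝓝ˢ (phaseOrbit r φ),
    ∀ (a b : ℝ) (ρ ψ : ℝ → ℝ), a < 0 → 0 < b →
      IsMotionOn I f V (Ioo a b) ρ ψ → HasMomentum f (Ioo a b) ρ ψ K₀ →
      phase ρ ψ 0 ∈ W → ∀ t ∈ Ico 0 b, phase ρ ψ t ∈ U

/-- `{r₀} × S¹` is an orbitally stable circular orbit, with angular momentum `K₀`. -/
def IsOrbitallyStable (I : Set ℝ) (f V : ℝ → ℝ) (r₀ K₀ : ℝ) : Prop :=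
  ∃ r φ, IsCircularTrajectory I f V r φ r₀ K₀ ∧ IsOrbitallyStableTrajectory I f V r φ K₀

/-- For some `ε > 0`, all nonsingular bounded orbits in the annulus `[r₀ - ε, r₀ + ε] × S¹` with
angular momentum in `(K₀ - ε, K₀ + ε)` are closed. -/
def NearbyOrbitsClosed (I : Set ℝ) (f V : ℝ → ℝ) (r₀ K₀ : ℝ) : Prop :=
  ∃ ε : ℝ, 0 < ε ∧ ∀ (r φ : ℝ → ℝ) (K : ℝ), IsNonsingularBounded I f V r φ K →
    (∀ t, r t ∈ Icc (r₀ - ε) (r₀ + ε)) → K ∈ Ioo (K₀ - ε) (K₀ + ε) → OrbitIsClosed r φ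

/-- Closing potential: a nonsingular bounded noncircular orbit exists, and all nonsingular
bounded orbits are closed. -/
def IsClosing (I : Set ℝ) (f V : ℝ → ℝ) : Prop :=
  (∃ r φ K, IsNonsingularBounded I f V r φ K ∧ ¬ OrbitIsCircular r φ) ∧
  ∀ r φ K, IsNonsingularBounded I f V r φ K → OrbitIsClosed r φ

/-- Every strongly stable circular orbit has closed nearby orbits. -/
def StronglyStableNearbyClosed (I : Set ℝ) (f V : ℝ → ℝ) : Prop :=
  ∀ r₀ K₀, IsStronglyStable I f V r₀ K₀ → NearbyOrbitsClosed I f V r₀ K₀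

/-- Locally closing potential. -/
def IsLocallyClosing (I : Set ℝ) (f V : ℝ → ℝ) : Prop :=
  (∃ r₀ K₀, IsStronglyStable I f V r₀ K₀) ∧ StronglyStableNearbyClosed I f V

/-- Semilocally closing potential: besides the local condition, there is a nonsingular bounded
noncircular orbit `γ`, with angular momentum `K`, such that all nonsingular bounded orbits with
the same angular momentum in the annulus `[inf r|γ, sup r|γ] × S¹` are closed. -/
def IsSemilocallyClosing (I : Set ℝ) (f V : ℝ → ℝ) : Prop :=
  (∃ r φ K, IsNonsingularBounded I f V r φ K ∧ ¬ OrbitIsCircular r φ ∧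
    ∀ ρ ψ, IsNonsingularBounded I f V ρ ψ K →
      (∀ t, ρ t ∈ Icc (sInf (range r)) (sSup (range r))) → OrbitIsClosed ρ ψ) ∧
  StronglyStableNearbyClosed I f V

/-- Strongly closing potential: every circle is a strongly stable circular orbit, and all these
circular orbits have closed nearby orbits. -/
def IsStronglyClosing (I : Set ℝ) (f V : ℝ → ℝ) : Prop :=
  (∀ r₀ ∈ I, ∃ K₀, IsStronglyStable I f V r₀ K₀) ∧ StronglyStableNearbyClosed I f V

/-- Weakly closing potential: every circle is an orbitally stable circular orbit, and all
orbitally stable circular orbits have closed nearby orbits. -/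
def IsWeaklyClosing (I : Set ℝ) (f V : ℝ → ℝ) : Prop :=
  (∀ r₀ ∈ I, ∃ K₀, IsOrbitallyStable I f V r₀ K₀) ∧
  ∀ r₀ K₀, IsOrbitallyStable I f V r₀ K₀ → NearbyOrbitsClosed I f V r₀ K₀

/-- The orbit is the curve `r = R(φ)`, where `R` is a periodic function with minimal positive
period `Φ`. -/
def OrbitIsPeriodicGraph (r φ : ℝ → ℝ) (Φ : ℝ) : Prop :=
  ∃ R : ℝ → ℝ, (∀ t, r t = R (φ t)) ∧
    orbit r φ = (range fun θ : ℝ => (R θ, (θ : Real.Angle))) ∧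
    IsLeast {T : ℝ | 0 < T ∧ Function.Periodic R T} Φ

/-- The boundary circle `{c} × S¹` of the surface is an attracting center: the infimum
(possibly `-∞`) of the potential over the surface is attained on it, as a limit. -/
def IsAttractingCenter (I : Set ℝ) (V : ℝ → ℝ) (c : ℝ) : Prop :=
  Tendsto (fun r => (V r : EReal)) (𝓝[I] c) (𝓝 (⨅ r ∈ I, (V r : EReal)))

/-- The profile function of the cone `dr² + ξ² r² dφ²`, `r > 0`. -/
def coneProfile (ξ : ℝ) (r : ℝ) : ℝ := ξ * r

/-- The potentials `(-1)^i A r^(i² - 2) / i + B` (gravitational for `i = 1`, oscillator for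
`i = 2`). -/
noncomputable def conePotential (i : ℕ) (A B : ℝ) (r : ℝ) : ℝ :=
  (-1) ^ i * A * r ^ ((i : ℤ) ^ 2 - 2) / i + B

/-- On `r > 0`, the function `V` is one of the potentials `conePotential i A B` with
`i = 1, 2` and `A > 0`. -/
def IsConePotential (V : ℝ → ℝ) : Prop :=
  ∃ i : ℕ, (i = 1 ∨ i = 2) ∧ ∃ A B : ℝ, 0 < A ∧ ∀ r : ℝ, 0 < r → V r = conePotential i A B r

end Revolution

namespace Revolution

/-! ### Circular orbits on the cone -/

/-! Everything is read off from G(r) = r³V'(r). With L = K/ξ the effective potential has derivative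
(G(r) − L²)/r³, so {r} × S¹ is a circular orbit of momentum K ≠ 0 exactly when G(r) = L², and it is
strongly stable exactly when moreover G'(r) > 0 (`isStronglyStable_iff`).

Necessity is a form of Bertrand's argument. In the variable u = 1/r, with θ = ξφ as time, the orbits
of momentum K oscillate in a potential with derivative `inverseRadiusForce`. Near a nondegenerate
minimum write u = g(s) so that this potential is a constant plus s²/2. An oscillation of amplitude ρ
is then s = ρ sin x with dθ = g'(ρ sin x) dx, and its period in θ is the integral of g'(ρ sin x)
over [0, 2π] (`exists_oscillation`). Closedness puts the period in the countable set 2πξℚ; being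
continuous in ρ, it is constant and equals its limit 2π/β, where β² = rG'/G
(`exists_chart_of_closed`). The same countability argument along the neighbouring circles makes β
constant, so G = A r^(β²) locally (`eventually_circularMomentumSq_eq_rpow`). Independence of the
amplitude also forces g'''(0) = 0, which for a power law leaves only β = 1 and β = 2
(`exponent_eq_one_or_two`). Since 1/β lies in ξℚ, ξ is rational. Finally, the set where G follows
the law is open and closed in (0, ∞) (`isConePotential_of_nearbyOrbitsClosed`).

Each of the five notions supplies a first circle with G > 0 and G' > 0. A closed noncircular orbit
does so because G ≤ L² at its least radius and G ≥ L² at its greatest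
(`exists_stable_of_closed_noncircular`). Orbital stability of all circles does so because otherwise
G is nonincreasing and the effective potential has a maximum, from which motions escape
(`exists_stable_of_orbitallyStable`).

Conversely, for the two potentials r⁻ⁱ is a constant plus a sinusoid in iξφ (`exists_conic`). This
gives the period 2π/(iξ) and, for rational ξ, closed orbits. As G is strictly increasing, every
circle is strongly stable, and it is orbitally stable by conservation of energy. -/

/-- The function `r³ V'(r)`: the value of `(K / ξ)²` for which `{r} × S¹` is a circular orbit. -/
noncomputable def circularMomentumSq (V : ℝ → ℝ) (r : ℝ) : ℝ := r ^ 3 * deriv V r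

section Smooth

theorem hasDerivAt_of_contDiffOn_Ioi {V : ℝ → ℝ} (hV : ContDiffOn ℝ ∞ V (Ioi 0)) {r : ℝ}
    (hr : 0 < r) : HasDerivAt V (deriv V r) r :=
  ((hV.differentiableOn (by simp)).differentiableAt (Ioi_mem_nhds hr)).hasDerivAt

theorem contDiffOn_deriv_Ioi {V : ℝ → ℝ} (hV : ContDiffOn ℝ ∞ V (Ioi 0)) :
    ContDiffOn ℝ ∞ (deriv V) (Ioi 0) :=
  hV.deriv_of_isOpen isOpen_Ioi (by simp)

theorem contDiffOn_circularMomentumSq {V : ℝ → ℝ} (hV : ContDiffOn ℝ ∞ V (Ioi 0)) :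
    ContDiffOn ℝ ∞ (circularMomentumSq V) (Ioi 0) :=
  (contDiff_id.pow 3).contDiffOn.mul (contDiffOn_deriv_Ioi hV)

theorem hasDerivAt_circularMomentumSq {V : ℝ → ℝ} (hV : ContDiffOn ℝ ∞ V (Ioi 0)) {r : ℝ}
    (hr : 0 < r) :
    HasDerivAt (circularMomentumSq V) (deriv (circularMomentumSq V) r) r :=
  hasDerivAt_of_contDiffOn_Ioi (contDiffOn_circularMomentumSq hV) hr

theorem deriv_eq_circularMomentumSq_div (V : ℝ → ℝ) {r : ℝ} (hr : 0 < r) :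
    deriv V r = circularMomentumSq V r / r ^ 3 := by
  unfold circularMomentumSq
  field_simp

end Smooth

section EffectivePotential

theorem hasDerivAt_effectivePotential {ξ : ℝ} (hξ : 0 < ξ) {V : ℝ → ℝ}
    (hV : ContDiffOn ℝ ∞ V (Ioi 0)) (K : ℝ) {r : ℝ} (hr : 0 < r) :
    HasDerivAt (effectivePotential (coneProfile ξ) V K)
      ((circularMomentumSq V r - (K / ξ) ^ 2) / r ^ 3) r := by
  have h1 : HasDerivAt (fun r : ℝ => 2 * (ξ * r) ^ 2) (2 * (2 * (ξ * r) * ξ)) r := by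
    exact ((((hasDerivAt_id r).const_mul ξ).pow 2).const_mul 2).congr_deriv (by simp)
  have h2 := (hasDerivAt_const r (K ^ 2)).div h1 (by positivity)
  have h3 := (hasDerivAt_of_contDiffOn_Ioi hV hr).add h2
  refine h3.congr_deriv ?_
  unfold circularMomentumSq
  field_simp
  ring

/-- At a critical point the numerator of (G − (K/ξ)²)/r³ vanishes, so only the derivative of G
survives. -/
theorem hasDerivAt_deriv_effectivePotential {ξ : ℝ} (hξ : 0 < ξ) {V : ℝ → ℝ}
    (hV : ContDiffOn ℝ ∞ V (Ioi 0)) {K r : ℝ} (hr : 0 < r)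
    (hK : (K / ξ) ^ 2 = circularMomentumSq V r) :
    HasDerivAt (deriv (effectivePotential (coneProfile ξ) V K))
      (deriv (circularMomentumSq V) r / r ^ 3) r := by
  have h1 : HasDerivAt (fun r => (circularMomentumSq V r - (K / ξ) ^ 2) / r ^ 3)
      (deriv (circularMomentumSq V) r / r ^ 3) r := by
    have h := ((hasDerivAt_circularMomentumSq hV hr).sub_const ((K / ξ) ^ 2)).div
      (hasDerivAt_pow 3 r) (by positivity)
    refine h.congr_deriv ?_
    rw [hK]
    field_simp
    ring
  refine h1.congr_of_eventuallyEq ?_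
  filter_upwards [Ioi_mem_nhds hr] with x hx
  exact (hasDerivAt_effectivePotential hξ hV K hx).deriv

end EffectivePotential

section Circular

theorem deriv_coneProfile (ξ r : ℝ) : deriv (coneProfile ξ) r = ξ := by
  exact (((hasDerivAt_id r).const_mul ξ).congr_deriv (mul_one ξ)).deriv

theorem OrbitIsCircle.eq_const {r φ : ℝ → ℝ} {r₀ : ℝ} (h : OrbitIsCircle r φ r₀) (t : ℝ) :
    r t = r₀ := by
  have : (r t, (φ t : Real.Angle)) ∈ ({r₀} ×ˢ (univ : Set Real.Angle)) := by
    rw [← h]; exact ⟨t, rfl⟩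
  simpa using this

/-- A trajectory with constant radius and nonzero angular momentum sweeps a circle. -/
theorem orbitIsCircle_of_eq_const {I J : Set ℝ} {f V : ℝ → ℝ} {r φ : ℝ → ℝ} {r₀ K : ℝ}
    (hJ : J = univ) (hm : IsMotionOn I f V J r φ) (hK : HasMomentum f J r φ K) (hK0 : K ≠ 0)
    (hr : ∀ t, r t = r₀) : OrbitIsCircle r φ r₀ := by
  subst hJ
  have hf : f r₀ ≠ 0 := by
    intro h0
    have := hK 0 (mem_univ _)
    rw [hr, h0] at this
    exact hK0 (by simpa using this.symm)
  have hd : ∀ t, HasDerivAt φ (K / f r₀ ^ 2) t := by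
    intro t
    have h := (hm t (mem_univ _)).2.2.1.hasDerivAt
    have h2 := hK t (mem_univ _)
    rw [hr] at h2
    rwa [← h2, mul_div_cancel_left₀ _ (pow_ne_zero 2 hf)]
  set w := K / f r₀ ^ 2 with hw
  have hw0 : w ≠ 0 := div_ne_zero hK0 (pow_ne_zero 2 hf)
  have hlin : ∀ t, φ t = φ 0 + w * t := by
    intro t
    have hc : ∀ x, HasDerivAt (fun t => φ t - w * t) 0 x := by
      intro x
      exact ((hd x).sub ((hasDerivAt_id x).const_mul w)).congr_deriv (by simp)
    have := is_const_of_deriv_eq_zero (fun x => (hc x).differentiableAt)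
      (fun x => (hc x).deriv) t 0
    simp at this
    linarith
  ext ⟨x, a⟩
  simp only [orbit, mem_range, Prod.mk.injEq, mem_prod, mem_singleton_iff, mem_univ, and_true]
  constructor
  · rintro ⟨t, h1, -⟩
    rw [← h1, hr]
  · rintro rfl
    induction a using Real.Angle.induction_on with
    | _ a =>
      refine ⟨(a - φ 0) / w, hr _, ?_⟩
      rw [hlin, mul_div_cancel₀ _ hw0]
      simp

/-- With K = 0 the angle would be constant and the orbit a single point, not a circle. The value of
K² is the radial equation with zero radial acceleration. -/
theorem IsCircularTrajectory.pos_and_momentum {ξ : ℝ} (hξ : 0 < ξ) {V r φ : ℝ → ℝ} {r₀ K : ℝ}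
    (h : IsCircularTrajectory (Ioi 0) (coneProfile ξ) V r φ r₀ K) :
    0 < r₀ ∧ K ≠ 0 ∧ (K / ξ) ^ 2 = circularMomentumSq V r₀ := by
  obtain ⟨hm, hK, hc⟩ := h
  have hr : ∀ t, r t = r₀ := hc.eq_const
  have hr0 : 0 < r₀ := by
    have := (hm 0 (mem_univ _)).1
    rwa [hr] at this
  have hrf : r = fun _ => r₀ := funext hr
  refine ⟨hr0, ?_, ?_⟩
  · rintro rfl
    have hd : ∀ t, deriv φ t = 0 := by
      intro t
      have := hK t (mem_univ _)
      rw [hr] at this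
      simpa [coneProfile, hξ.ne', hr0.ne'] using this
    have hφ : ∀ t, φ t = φ 0 := fun t =>
      is_const_of_deriv_eq_zero (fun x => (hm x (mem_univ _)).2.2.1) hd t 0
    have hmem : ∀ a : Real.Angle, a = (φ 0 : Real.Angle) := by
      intro a
      have : (r₀, a) ∈ orbit r φ := by
        rw [hc]; simp
      obtain ⟨t, ht⟩ := this
      simp only [Prod.mk.injEq] at ht
      rw [← ht.2, hφ]
    have h0 := hmem 0
    have h1 := hmem (Real.pi : ℝ)
    rw [← h0] at h1
    exact Real.Angle.pi_ne_zero h1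
  · have h1 := (hm 0 (mem_univ _)).2.2.2.1
    have h2 := hK 0 (mem_univ _)
    have h3 : HasDerivAt (deriv r) 0 0 := by
      rw [hrf]
      simpa using hasDerivAt_const (0 : ℝ) (0 : ℝ)
    have h4 := h1.unique h3
    rw [hr] at h4 h2
    rw [deriv_coneProfile] at h4
    unfold circularMomentumSq
    have h6 : deriv V r₀ = coneProfile ξ r₀ * ξ * deriv φ 0 ^ 2 := by linarith
    rw [h6, ← h2]
    unfold coneProfile
    field_simp

theorem exists_isCircularTrajectory {ξ : ℝ} (hξ : 0 < ξ) {V : ℝ → ℝ} {r₀ K : ℝ} (hr₀ : 0 < r₀)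
    (hK0 : K ≠ 0) (hK : (K / ξ) ^ 2 = circularMomentumSq V r₀) :
    ∃ r φ, IsCircularTrajectory (Ioi 0) (coneProfile ξ) V r φ r₀ K := by
  set w := K / (ξ * r₀) ^ 2 with hw
  have hd : ∀ t, HasDerivAt (fun t => w * t) w t := fun t => by
    simpa using (hasDerivAt_id t).const_mul w
  have hd' : deriv (fun t => w * t) = fun _ => w := funext fun t => (hd t).deriv
  have hm : IsMotionOn (Ioi 0) (coneProfile ξ) V univ (fun _ => r₀) (fun t => w * t) := by
    intro t _
    refine ⟨hr₀, differentiableAt_const _, (hd t).differentiableAt, ?_, ?_⟩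
    · rw [hd', deriv_coneProfile, deriv_eq_circularMomentumSq_div V hr₀, ← hK]
      have : deriv (fun _ : ℝ => r₀) = fun _ => 0 := by simp
      rw [this]
      refine (hasDerivAt_const t (0 : ℝ)).congr_deriv ?_
      simp only [coneProfile, hw]
      field_simp
      ring
    · rw [hd']
      exact hasDerivAt_const _ _
  have hmom : HasMomentum (coneProfile ξ) univ (fun _ => r₀) (fun t => w * t) K := by
    intro t _
    rw [hd']
    simp only [coneProfile, hw]
    field_simp
  exact ⟨_, _, hm, hmom, orbitIsCircle_of_eq_const rfl hm hmom hK0 fun _ => rfl⟩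

theorem iteratedDeriv_two_eq (f : ℝ → ℝ) : iteratedDeriv 2 f = deriv (deriv f) := by
  rw [iteratedDeriv_succ, iteratedDeriv_one]

/-- Strong stability of a circle in terms of the function `r³ V'(r)`. -/
theorem isStronglyStable_iff {ξ : ℝ} (hξ : 0 < ξ) {V : ℝ → ℝ} (hV : ContDiffOn ℝ ∞ V (Ioi 0))
    {r₀ K : ℝ} : IsStronglyStable (Ioi 0) (coneProfile ξ) V r₀ K ↔
      0 < r₀ ∧ K ≠ 0 ∧ (K / ξ) ^ 2 = circularMomentumSq V r₀ ∧
        0 < deriv (circularMomentumSq V) r₀ := by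
  constructor
  · rintro ⟨⟨r, φ, h⟩, hK0, hmin, hne⟩
    obtain ⟨hr₀, -, hK⟩ := h.pos_and_momentum hξ
    refine ⟨hr₀, hK0, hK, ?_⟩
    have h2 := (hasDerivAt_deriv_effectivePotential hξ hV hr₀ hK).deriv
    have h1 := (hasDerivAt_effectivePotential hξ hV K hr₀)
    rw [iteratedDeriv_two_eq, h2] at hne
    by_contra hcon
    have hneg : deriv (circularMomentumSq V) r₀ / r₀ ^ 3 < 0 :=
      lt_of_le_of_ne (div_nonpos_of_nonpos_of_nonneg (not_lt.1 hcon) (by positivity)) hne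
    have h1' : deriv (effectivePotential (coneProfile ξ) V K) r₀ = 0 := by
      rw [h1.deriv, hK, sub_self, zero_div]
    -- A negative second derivative would make r₀ a local maximum as well as a minimum, hence the
    -- function locally constant, with second derivative zero.
    have hmax := isLocalMax_of_deriv_deriv_neg (by rw [h2]; exact hneg) h1' h1.continuousAt
    have heq : effectivePotential (coneProfile ξ) V K =ᶠ[𝓝 r₀]
        fun _ => effectivePotential (coneProfile ξ) V K r₀ := by
      filter_upwards [hmin, hmax] with x h3 h4
      exact le_antisymm h4 h3
    have := heq.deriv.deriv_eq
    rw [h2] at this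
    simp at this
    rw [div_eq_zero_iff.2 (by simpa using this)] at hneg
    exact lt_irrefl _ hneg
  · rintro ⟨hr₀, hK0, hK, hpos⟩
    have h2 := (hasDerivAt_deriv_effectivePotential hξ hV hr₀ hK).deriv
    have h1 := (hasDerivAt_effectivePotential hξ hV K hr₀)
    have h1' : deriv (effectivePotential (coneProfile ξ) V K) r₀ = 0 := by
      rw [h1.deriv, hK, sub_self, zero_div]
    have h3 : 0 < deriv (deriv (effectivePotential (coneProfile ξ) V K)) r₀ := by
      rw [h2]; positivity
    refine ⟨exists_isCircularTrajectory hξ hr₀ hK0 hK, hK0,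
      isLocalMin_of_deriv_deriv_pos h3 h1' h1.continuousAt, ?_⟩
    rw [iteratedDeriv_two_eq]
    exact h3.ne'

end Circular

end Revolution

namespace Revolution

/-! ### The square-root coordinate at a nondegenerate minimum -/

section SquareRoot

/-- The coordinate `s` with `U = U(c) + s² / 2` near a nondegenerate minimum `c` of `U`. -/
noncomputable def sqrtCoordinate (U : ℝ → ℝ) (c u : ℝ) : ℝ :=
  (u - c) * √(2 * ((U u - U c) / (u - c) ^ 2))

variable {U U' : ℝ → ℝ} {c β : ℝ}

/-- By l'Hôpital the quotient behaves like U'(u) / (2(u − c)), half the slope of U' at c; U' need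
only be differentiable at c itself. -/
theorem tendsto_sub_div_sq (hU : ∀ᶠ u in 𝓝 c, HasDerivAt U (U' u) u) (hc : U' c = 0)
    (hU'' : HasDerivAt U' (β ^ 2) c) :
    Tendsto (fun u => (U u - U c) / (u - c) ^ 2) (𝓝[≠] c) (𝓝 (β ^ 2 / 2)) := by
  refine HasDerivAt.lhopital_zero_nhdsNE (f' := U') (g' := fun u => 2 * (u - c)) ?_ ?_ ?_ ?_ ?_ ?_
  · filter_upwards [nhdsWithin_le_nhds hU] with u hu using hu.sub_const _
  · refine Eventually.of_forall fun u => ?_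
    exact (((hasDerivAt_id u).sub_const c).pow 2).congr_deriv (by simp)
  · filter_upwards [self_mem_nhdsWithin] with u hu
    exact mul_ne_zero two_ne_zero (sub_ne_zero.2 hu)
  · have := (hU.self_of_nhds.continuousAt.tendsto.sub_const (U c)).mono_left
      (nhdsWithin_le_nhds (s := {c}ᶜ))
    simpa using this
  · have : ContinuousAt (fun u => (u - c) ^ 2) c := by fun_prop
    have := this.tendsto.mono_left (nhdsWithin_le_nhds (s := {c}ᶜ))
    simpa using this
  · have h := hasDerivAt_iff_tendsto_slope.1 hU''
    refine (h.div_const 2).congr fun u => ?_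
    rw [slope_def_field, hc, sub_zero, div_div, mul_comm]

theorem eventually_sqrtCoordinate_sq (hβ : 0 < β)
    (hU : ∀ᶠ u in 𝓝 c, HasDerivAt U (U' u) u) (hc : U' c = 0)
    (hU'' : HasDerivAt U' (β ^ 2) c) :
    ∀ᶠ u in 𝓝 c, U u = U c + sqrtCoordinate U c u ^ 2 / 2 := by
  have h := (tendsto_sub_div_sq hU hc hU'').eventually (lt_mem_nhds (show 0 < β ^ 2 / 2 by positivity))
  rw [eventually_nhdsWithin_iff] at h
  filter_upwards [h] with u hu
  rcases eq_or_ne u c with rfl | hne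
  · simp [sqrtCoordinate]
  · have h1 := hu hne
    have h2 : u - c ≠ 0 := sub_ne_zero.2 hne
    rw [sqrtCoordinate, mul_pow, Real.sq_sqrt (by positivity)]
    field_simp
    ring

theorem hasDerivAt_sqrtCoordinate_self (hβ : 0 < β)
    (hU : ∀ᶠ u in 𝓝 c, HasDerivAt U (U' u) u) (hc : U' c = 0)
    (hU'' : HasDerivAt U' (β ^ 2) c) : HasDerivAt (sqrtCoordinate U c) β c := by
  rw [hasDerivAt_iff_tendsto_slope]
  have h := ((tendsto_sub_div_sq hU hc hU'').const_mul 2).sqrt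
  have h2 : √(2 * (β ^ 2 / 2)) = β := by
    rw [mul_div_cancel₀ _ two_ne_zero, Real.sqrt_sq hβ.le]
  rw [h2] at h
  refine h.congr' ?_
  filter_upwards [self_mem_nhdsWithin] with u hu
  have : u - c ≠ 0 := sub_ne_zero.2 hu
  rw [slope_def_field]
  simp only [sqrtCoordinate, sub_self, zero_mul, sub_zero]
  rw [mul_div_cancel_left₀ _ this]

/-- Differentiating U = U(c) + σ²/2 gives σ' = U'/σ off c. As a quotient of slopes at c this tends
to β²/β = β, which is σ'(c). Only C¹ is obtained, and that is enough for continuity of the period.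
-/
theorem contDiffAt_sqrtCoordinate (hβ : 0 < β)
    (hU : ∀ᶠ u in 𝓝 c, HasDerivAt U (U' u) u) (hc : U' c = 0)
    (hcont : ∀ᶠ u in 𝓝 c, ContinuousAt U' u)
    (hU'' : HasDerivAt U' (β ^ 2) c) : ContDiffAt ℝ 1 (sqrtCoordinate U c) c := by
  have hσ := hasDerivAt_sqrtCoordinate_self hβ hU hc hU''
  have hlim := tendsto_sub_div_sq hU hc hU''
  have hQ := hlim.eventually (lt_mem_nhds (show 0 < β ^ 2 / 2 by positivity))
  rw [eventually_nhdsWithin_iff] at hQ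
  obtain ⟨ε, hε, hball⟩ := Metric.eventually_nhds_iff_ball.1
    ((hU.and hcont).and (hQ.and (eventually_sqrtCoordinate_sq hβ hU hc hU'')))
  set σ := sqrtCoordinate U c with hσdef
  have hσ0 : ∀ u ∈ Metric.ball c ε, u ≠ c → σ u ≠ 0 := by
    intro u hu hne
    have := (hball u hu).2.1 hne
    exact mul_ne_zero (sub_ne_zero.2 hne) (Real.sqrt_ne_zero'.2 (by positivity))
  have hder : ∀ u ∈ Metric.ball c ε, u ≠ c → HasDerivAt σ (U' u / σ u) u := by
    intro u hu hne
    have h2 : u - c ≠ 0 := sub_ne_zero.2 hne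
    have hQu := (hball u hu).2.1 hne
    have hdiff : DifferentiableAt ℝ σ u := by
      have hd : DifferentiableAt ℝ U u := (hball u hu).1.1.differentiableAt
      have h3 : DifferentiableAt ℝ (fun u => 2 * ((U u - U c) / (u - c) ^ 2)) u :=
        (differentiableAt_const _).mul (((hd.sub_const _)).div (by fun_prop) (pow_ne_zero 2 h2))
      exact ((differentiableAt_id.sub_const c)).mul (h3.sqrt (by positivity))
    have h4 : HasDerivAt U (0 + (2 * σ u * deriv σ u) / 2) u := by
      have h5 := ((hasDerivAt_const u (U c)).add ((hdiff.hasDerivAt.pow 2).div_const 2))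
      have h6 : HasDerivAt U _ u := h5.congr_of_eventuallyEq (by
        filter_upwards [Metric.isOpen_ball.mem_nhds hu] with v hv
        exact (hball v hv).2.2)
      exact h6.congr_deriv (by simp)
    have h7 := h4.unique (hball u hu).1.1
    have h8 : U' u / σ u = deriv σ u := by
      rw [← h7]
      field_simp [hσ0 u hu hne]
      ring
    rw [h8]
    exact hdiff.hasDerivAt
  rw [contDiffAt_one_iff]
  set τ : ℝ → ℝ := fun u => if u = c then β else U' u / σ u with hτ
  refine ⟨fun u => ContinuousLinearMap.toSpanSingleton ℝ (τ u), Metric.ball c ε,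
    Metric.ball_mem_nhds c hε, ?_, ?_⟩
  · have hτc : ContinuousOn τ (Metric.ball c ε) := by
      intro u hu
      refine ContinuousAt.continuousWithinAt ?_
      rcases eq_or_ne u c with rfl | hne
      · rw [continuousAt_iff_punctured_nhds]
        have h1 : Tendsto (fun v => slope U' u v / slope σ u v) (𝓝[≠] u) (𝓝 (β ^ 2 / β)) :=
          (hasDerivAt_iff_tendsto_slope.1 hU'').div (hasDerivAt_iff_tendsto_slope.1 hσ) hβ.ne'
        have h2 : τ u = β ^ 2 / β := by
          simp only [hτ, if_true]
          field_simp
        rw [h2]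
        refine h1.congr' ?_
        filter_upwards [self_mem_nhdsWithin] with v hv
        have h3 : v - u ≠ 0 := sub_ne_zero.2 hv
        have h4 : σ u = 0 := by simp [hσdef, sqrtCoordinate]
        simp only [hτ, slope_def_field, hc, h4, sub_zero]
        rw [if_neg (show ¬ v = u from hv), div_div_div_cancel_right₀ h3]
      · have h1 : ContinuousAt (fun v => U' v / σ v) u :=
          (hball u hu).1.2.div (hder u hu hne).continuousAt (hσ0 u hu hne)
        refine h1.congr ?_
        filter_upwards [isOpen_ne.mem_nhds hne] with v hv
        simp only [hτ]
        rw [if_neg hv]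
    exact (ContinuousLinearMap.toSpanSingletonCLE (𝕜 := ℝ) (E := ℝ)).continuous.comp_continuousOn hτc
  · intro u hu
    rcases eq_or_ne u c with rfl | hne
    · simpa [hτ] using hσ.hasFDerivAt
    · simpa [hτ, hne] using (hder u hu hne).hasFDerivAt

/-- For analytic U the second divided difference at c is analytic and positive there, so its square
root loses no derivatives. This provides the higher regularity needed to use third derivatives of
the chart. -/
theorem contDiffAt_sqrtCoordinate_of_analyticAt {n : WithTop ℕ∞} (hβ : 0 < β) (hUa : AnalyticAt ℝ U c)
    (hU : ∀ᶠ u in 𝓝 c, HasDerivAt U (U' u) u) (hc : U' c = 0)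
    (hU'' : HasDerivAt U' (β ^ 2) c) : ContDiffAt ℝ n (sqrtCoordinate U c) c := by
  obtain ⟨p, hp⟩ := hUa
  set q := dslope (dslope U c) c with hq
  have hqa : AnalyticAt ℝ q c :=
    ⟨_, hp.has_fpower_series_dslope_fslope.has_fpower_series_dslope_fslope⟩
  have hUc : deriv U c = 0 := by rw [hU.self_of_nhds.deriv, hc]
  have hqeq : ∀ u, u ≠ c → q u = (U u - U c) / (u - c) ^ 2 := by
    intro u hu
    rw [hq, dslope_of_ne _ hu, slope_def_field, dslope_same, hUc, dslope_of_ne _ hu,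
      slope_def_field, sub_zero, div_div, sq]
  have hqc : q c = β ^ 2 / 2 := by
    refine tendsto_nhds_unique (hqa.continuousAt.tendsto.mono_left
      (nhdsWithin_le_nhds (s := {c}ᶜ))) ((tendsto_sub_div_sq hU hc hU'').congr' ?_)
    filter_upwards [self_mem_nhdsWithin] with u hu
    exact (hqeq u hu).symm
  have hσ : sqrtCoordinate U c = fun u => (u - c) * √(2 * q u) := by
    funext u
    rcases eq_or_ne u c with rfl | hne
    · simp [sqrtCoordinate]
    · rw [sqrtCoordinate, hqeq u hne]
  rw [hσ]
  refine (contDiffAt_id.sub contDiffAt_const).mul ?_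
  refine (contDiffAt_const.mul hqa.contDiffAt).sqrt ?_
  rw [hqc]
  positivity

end SquareRoot

/-! ### Charts in which the potential is a constant plus s²/2. -/

section Chart

/-- A parametrization `u = g(s)` of a neighbourhood of the critical point `c` of a function with
derivative `U'`, in which this function is `const + s² / 2`. -/
structure IsMinChart (U' : ℝ → ℝ) (c δ : ℝ) (g : ℝ → ℝ) : Prop where
  pos : 0 < δ
  map_zero : g 0 = c
  hasDerivAt : ∀ s ∈ Ioo (-δ) δ, HasDerivAt g (deriv g s) s
  deriv_pos : ∀ s ∈ Ioo (-δ) δ, 0 < deriv g s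
  deriv_mul : ∀ s ∈ Ioo (-δ) δ, deriv g s * U' (g s) = s
  continuousOn : ContinuousOn (deriv g) (Ioo (-δ) δ)

/-- The chart is the local inverse of `sqrtCoordinate`, with the regularity n of that coordinate.
The set N lets the chart be confined to a prescribed neighbourhood. -/
theorem exists_isMinChart {U U' : ℝ → ℝ} {c β : ℝ} (hβ : 0 < β)
    (hU : ∀ᶠ u in 𝓝 c, HasDerivAt U (U' u) u) (hc : U' c = 0)
    (hU'' : HasDerivAt U' (β ^ 2) c) {n : WithTop ℕ∞} (hn : 1 ≤ n)
    (hσn : ContDiffAt ℝ n (sqrtCoordinate U c) c) {N : Set ℝ} (hN : N ∈ 𝓝 c) :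
    ∃ g δ, IsMinChart U' c δ g ∧ deriv g 0 = 1 / β ∧ (∀ s ∈ Ioo (-δ) δ, g s ∈ N) ∧
      ContDiffAt ℝ n g 0 := by
  set σ := sqrtCoordinate U c with hσdef
  have hσ : HasDerivAt σ β c := hasDerivAt_sqrtCoordinate_self hβ hU hc hU''
  have hσc : σ c = 0 := by simp [hσdef, sqrtCoordinate]
  have hn0 : n ≠ 0 := fun h => by simp [h] at hn
  have hstrict : HasStrictDerivAt σ β c := hσn.hasStrictDerivAt' hσ hn0
  have hF := hσ.hasFDerivAt_equiv hβ.ne'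
  set g := hσn.localInverse hF hn0 with hg
  have hgn : ContDiffAt ℝ n g 0 := by
    have := hσn.to_localInverse hF hn0
    rwa [hσc] at this
  have hg0 : g 0 = c := by
    have := hσn.localInverse_apply_image hF hn0
    rwa [hσc] at this
  have hinv : ∀ᶠ s in 𝓝 0, σ (g s) = s := by
    have := (hσn.hasStrictFDerivAt' hF hn0).eventually_right_inverse
    rwa [hσc] at this
  have hg1 : ContDiffAt ℝ 1 g 0 := hgn.of_le hn
  have hev1 : ∀ᶠ s in 𝓝 0, ContDiffAt ℝ 1 g s := hg1.eventually (by simp)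
  have hcd : ∀ {s}, ContDiffAt ℝ 1 g s → ContinuousAt (deriv g) s := by
    intro s hs
    exact (hs.derivWithin (m := 0) (by simp)).continuousAt
  have hgc : ContinuousAt g 0 := hg1.continuousAt
  -- This is the derivative of U(g(s)) = U(c) + s²/2.
  have hdg : ∀ᶠ s in 𝓝 0, deriv g s * U' (g s) = s := by
    have hsq := eventually_sqrtCoordinate_sq hβ hU hc hU''
    rw [← hg0] at hsq
    have h1 : ∀ᶠ s in 𝓝 (0 : ℝ), U (g s) = U c + s ^ 2 / 2 := by
      filter_upwards [hgc.eventually hsq, hinv] with s h2 h3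
      rw [hg0, ← hσdef, h3] at h2
      exact h2
    rw [← hg0] at hU
    filter_upwards [h1.eventually_nhds, hgc.eventually hU, hev1] with s h2 h3 h4
    have h5 := h3.comp s (h4.differentiableAt (by simp)).hasDerivAt
    have h6 : HasDerivAt (fun s : ℝ => U c + s ^ 2 / 2) s s := by
      exact ((hasDerivAt_const s (U c)).add ((hasDerivAt_pow 2 s).div_const 2)).congr_deriv
        (by simp)
    have h7 := h5.unique (h6.congr_of_eventuallyEq h2)
    rw [mul_comm]; exact h7
  have hd0 : deriv g 0 = 1 / β := by
    have h1 := (hg1.differentiableAt (by simp)).hasDerivAt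
    rw [← hg0] at hσ
    have h2 := (hσ.comp 0 h1).unique ((hasDerivAt_id (0 : ℝ)).congr_of_eventuallyEq hinv)
    field_simp
    linarith
  have hpos : ∀ᶠ s in 𝓝 0, 0 < deriv g s :=
    (hcd hg1).eventually (lt_mem_nhds (by rw [hd0]; positivity))
  have hNg : ∀ᶠ s in 𝓝 0, g s ∈ N := hgc.eventually (by rwa [hg0])
  obtain ⟨δ, hδ, hball⟩ := Metric.eventually_nhds_iff_ball.1
    ((hev1.and hdg).and (hpos.and hNg))
  rw [Real.ball_eq_Ioo, zero_sub, zero_add] at hball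
  exact ⟨g, δ, ⟨hδ, hg0, fun s hs => ((hball s hs).1.1.differentiableAt (by simp)).hasDerivAt,
    fun s hs => (hball s hs).2.1, fun s hs => (hball s hs).1.2,
    fun s hs => (hcd (hball s hs).1.1).continuousWithinAt⟩, hd0, fun s hs => (hball s hs).2.2, hgn⟩

end Chart

end Revolution

namespace Revolution

/-! ### Oscillating orbits -/

section TimeChange

/-- The solution is the inverse function of the integral of b. The lower bound m makes that integral
surjective onto ℝ, so the solution exists for all time. -/
theorem exists_hasDerivAt_inv_comp {b : ℝ → ℝ} (hb : Continuous b) {m : ℝ} (hm : 0 < m)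
    (hbm : ∀ x, m ≤ b x) : ∃ α : ℝ → ℝ, α 0 = 0 ∧ ∀ t, HasDerivAt α (b (α t))⁻¹ t := by
  set F : ℝ → ℝ := fun x => ∫ y in (0 : ℝ)..x, b y with hF
  have hFd : ∀ x, HasDerivAt F (b x) x := fun x =>
    intervalIntegral.integral_hasDerivAt_right (hb.intervalIntegrable _ _)
      (hb.stronglyMeasurableAtFilter _ _) hb.continuousAt
  have hbpos : ∀ x, 0 < b x := fun x => hm.trans_le (hbm x)
  have hmono : StrictMono F := strictMono_of_deriv_pos fun x => by
    rw [(hFd x).deriv]; exact hbpos x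
  have hFc : Continuous F := continuous_iff_continuousAt.2 fun x => (hFd x).continuousAt
  have hF0 : F 0 = 0 := by simp [hF]
  have hmono2 : Monotone fun x => F x - m * x := by
    refine monotone_of_deriv_nonneg (fun x => ?_) fun x => ?_
    · exact ((hFd x).sub ((hasDerivAt_id x).const_mul m)).differentiableAt
    · have h := ((hFd x).sub ((hasDerivAt_id x).const_mul m)).deriv
      have h2 : deriv (fun x => F x - m * x) x = b x - m * 1 := h
      rw [h2]
      linarith [hbm x]
  have hsurj : Function.Surjective F := by
    refine hFc.surjective ?_ ?_
    · refine tendsto_atTop_mono' atTop ?_ (tendsto_id.const_mul_atTop hm)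
      filter_upwards [eventually_ge_atTop 0] with x hx
      have := hmono2 hx
      simp only [hF0] at this
      simp only [id]
      linarith
    · refine tendsto_atBot_mono' atBot ?_ (tendsto_id.const_mul_atBot hm)
      filter_upwards [eventually_le_atBot 0] with x hx
      have := hmono2 hx
      simp only [hF0] at this
      simp only [id]
      linarith
  set e := (hmono.orderIsoOfSurjective F hsurj) with he
  have hright : ∀ t, F (e.symm t) = t := fun t => e.apply_symm_apply t
  refine ⟨e.symm, ?_, fun t => ?_⟩
  · apply hmono.injective
    rw [hright, hF0]
  · exact HasDerivAt.of_local_left_inverse e.symm.continuous.continuousAt (hFd _) (hbpos _).ne'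
      (Eventually.of_forall hright)

end TimeChange

section Oscillation

/-- The derivative of the effective potential `u² / 2 + V(1 / u) / L²` in the variable
`u = 1 / r`, with the angle `ξ φ` as time. -/
noncomputable def inverseRadiusForce (V : ℝ → ℝ) (L u : ℝ) : ℝ :=
  u * (1 - circularMomentumSq V u⁻¹ / L ^ 2)

/-- The angular period, multiplied by `ξ`, of the oscillation of amplitude `ρ` in the chart. -/
noncomputable def chartPeriod (g : ℝ → ℝ) (ρ : ℝ) : ℝ :=
  ∫ x in (0 : ℝ)..2 * Real.pi, deriv g (ρ * Real.sin x)

theorem mul_sin_mem_Icc {ρ : ℝ} (hρ : 0 ≤ ρ) (x : ℝ) : ρ * Real.sin x ∈ Icc (-ρ) ρ :=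
  ⟨by nlinarith [Real.neg_one_le_sin x], by nlinarith [Real.sin_le_one x]⟩

/-- With s = ρ sin x, energy conservation reads dθ = g'(s) dx, and r² dθ = L dt up to sign. The
phase x = α(t) therefore satisfies b(α) α' = 1 with b = g'/(L g²), and the trajectory is built from
α. If it closes up after time T, the radial velocity −Lρ cos α forces α(T) = 2πk with k ≠ 0. The
angle has then advanced by ±k/ξ times the period, which must be a multiple of 2π. -/
theorem exists_oscillation {ξ : ℝ} (hξ : 0 < ξ) {V : ℝ → ℝ} {K : ℝ} (hK : K ≠ 0)
    {c δ : ℝ} {g : ℝ → ℝ} (hg : IsMinChart (inverseRadiusForce V (K / ξ)) c δ g)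
    (hpos : ∀ s ∈ Ioo (-δ) δ, 0 < g s) {ρ : ℝ} (hρ : 0 < ρ) (hρδ : ρ < δ) :
    ∃ r φ, IsNonsingularBounded (Ioi 0) (coneProfile ξ) V r φ K ∧
      (∀ t, ∃ s ∈ Ioo (-δ) δ, r t = (g s)⁻¹) ∧ ¬ OrbitIsCircular r φ ∧
      (OrbitIsClosed r φ → ∃ q : ℚ, chartPeriod g ρ = 2 * Real.pi * ξ * q) := by
  -- The absolute value makes the phase run forwards; the sign of K is carried by κ = ±1/ξ below.
  set L := |K / ξ| with hLdef
  have hL : 0 < L := abs_pos.2 (div_ne_zero hK hξ.ne')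
  have hL2 : (K / ξ) ^ 2 = L ^ 2 := by rw [hLdef, sq_abs]
  have hsub : Icc (-ρ) ρ ⊆ Ioo (-δ) δ := Icc_subset_Ioo (by linarith) hρδ
  have hmem : ∀ x, ρ * Real.sin x ∈ Ioo (-δ) δ := fun x => hsub (mul_sin_mem_Icc hρ.le x)
  have hsin : Continuous fun x => ρ * Real.sin x := by fun_prop
  set a : ℝ → ℝ := fun x => deriv g (ρ * Real.sin x) with ha
  have hgc : ContinuousOn g (Ioo (-δ) δ) := fun s hs =>
    (hg.hasDerivAt s hs).continuousAt.continuousWithinAt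
  have hac : Continuous a := hg.continuousOn.comp_continuous hsin hmem
  have hapos : ∀ x, 0 < a x := fun x => hg.deriv_pos _ (hmem x)
  set G : ℝ → ℝ := fun x => g (ρ * Real.sin x) with hG
  have hGc : Continuous G := hgc.comp_continuous hsin hmem
  have hGpos : ∀ x, 0 < G x := fun x => hpos _ (hmem x)
  have hGd : ∀ x, HasDerivAt G (a x * (ρ * Real.cos x)) x := fun x =>
    (hg.hasDerivAt _ (hmem x)).comp x ((Real.hasDerivAt_sin x).const_mul ρ)
  set b : ℝ → ℝ := fun x => a x / (L * G x ^ 2) with hb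
  have hbc : Continuous b := hac.div (by fun_prop) fun x => by have := hGpos x; positivity
  have hbpos : ∀ x, 0 < b x := fun x => by
    have := hGpos x; have := hapos x; simp only [hb]; positivity
  have haper : Function.Periodic a (2 * Real.pi) := fun x => by
    simp only [ha, Real.sin_add_two_pi]
  have hbper : Function.Periodic b (2 * Real.pi) := fun x => by
    simp only [hb, hG, ha, Real.sin_add_two_pi]
  -- A positive continuous periodic function is bounded below by its minimum over one period.
  obtain ⟨m, hm, hbm⟩ : ∃ m, 0 < m ∧ ∀ x, m ≤ b x := by
    obtain ⟨x₀, -, hx₀⟩ := (isCompact_Icc (a := (0 : ℝ)) (b := 2 * Real.pi)).exists_isMinOn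
      (nonempty_Icc.2 (by positivity)) hbc.continuousOn
    refine ⟨b x₀, hbpos _, fun x => ?_⟩
    obtain ⟨y, hy, hxy⟩ := hbper.exists_mem_Ico₀ (by positivity) x
    rw [hxy]
    exact hx₀ (Ico_subset_Icc_self hy)
  obtain ⟨α, hα0, hα⟩ := exists_hasDerivAt_inv_comp hbc hm hbm
  set r : ℝ → ℝ := fun t => (G (α t))⁻¹ with hr
  have hrd : ∀ t, HasDerivAt r (-(L * ρ * Real.cos (α t))) t := by
    intro t
    have h := ((hGd (α t)).comp t (hα t)).inv (hGpos (α t)).ne'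
    refine h.congr_deriv ?_
    have h1 := hGpos (α t)
    have h2 := hapos (α t)
    simp only [hb, Function.comp]
    field_simp
  have hrd' : deriv r = fun t => -(L * ρ * Real.cos (α t)) := funext fun t => (hrd t).deriv
  have hrpos : ∀ t, 0 < r t := fun t => inv_pos.2 (hGpos _)
  set κ := K / (ξ ^ 2 * L) with hκ
  set θ : ℝ → ℝ := fun x => ∫ y in (0 : ℝ)..x, a y with hθ
  have hθd : ∀ x, HasDerivAt θ (a x) x := fun x =>
    intervalIntegral.integral_hasDerivAt_right (hac.intervalIntegrable _ _)
      (hac.stronglyMeasurableAtFilter _ _) hac.continuousAt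
  set φ : ℝ → ℝ := fun t => κ * θ (α t) with hφ
  have hφd : ∀ t, HasDerivAt φ (K / (ξ * r t) ^ 2) t := by
    intro t
    refine (((hθd (α t)).comp t (hα t)).const_mul κ).congr_deriv ?_
    have h1 := hGpos (α t)
    have h2 := hapos (α t)
    simp only [hb, hκ, hr]
    field_simp
  have hφd' : deriv φ = fun t => K / (ξ * r t) ^ 2 := funext fun t => (hφd t).deriv
  have hmom : ∀ t, coneProfile ξ (r t) ^ 2 * deriv φ t = K := by
    intro t
    have := hrpos t
    rw [hφd']
    simp only [coneProfile]
    field_simp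
  have hmotion : IsMotionOn (Ioi 0) (coneProfile ξ) V univ r φ := by
    intro t _
    refine ⟨hrpos t, (hrd t).differentiableAt, (hφd t).differentiableAt, ?_, ?_⟩
    · rw [hrd', hφd', deriv_coneProfile, deriv_eq_circularMomentumSq_div V (hrpos t)]
      have h := (((Real.hasDerivAt_cos (α t)).comp t (hα t)).const_mul (L * ρ)).neg
      refine h.congr_deriv ?_
      have h1 := hGpos (α t)
      have h2 := hapos (α t)
      have h3 := hg.deriv_mul _ (hmem (α t))
      have h4 : a (α t) * (G (α t) * (1 - circularMomentumSq V (r t) / L ^ 2)) =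
          ρ * Real.sin (α t) := by
        rw [← hL2]; exact h3
      have hrG : r t = (G (α t))⁻¹ := rfl
      have h5 : (b (α t))⁻¹ = L * G (α t) ^ 2 / a (α t) := by simp only [hb, inv_div]
      have h6 : coneProfile ξ (r t) * ξ * (K / (ξ * r t) ^ 2) ^ 2 = L ^ 2 / r t ^ 3 := by
        rw [← hL2]
        have := hrpos t
        simp only [coneProfile]
        field_simp
      rw [h5, h6]
      calc _ = L * (L * G (α t) ^ 2) * (ρ * Real.sin (α t)) / a (α t) := by ring
        _ = L * (L * G (α t) ^ 2) * (G (α t) * (1 - circularMomentumSq V (r t) / L ^ 2)) := by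
            rw [← h4]; field_simp
        _ = _ := by
            rw [hrG]
            field_simp
    · have : (fun s => coneProfile ξ (r s) ^ 2 * deriv φ s) = fun _ => K := funext hmom
      rw [this]
      exact hasDerivAt_const _ _
  have hgmono : StrictMonoOn g (Ioo (-δ) δ) :=
    strictMonoOn_of_deriv_pos (convex_Ioo _ _) hgc fun s hs => by
      rw [interior_Ioo] at hs; exact hg.deriv_pos s hs
  have hK' : HasMomentum (coneProfile ξ) univ r φ K := fun t _ => hmom t
  have hρm : ρ ∈ Ioo (-δ) δ := ⟨by linarith, hρδ⟩
  have hρm' : -ρ ∈ Ioo (-δ) δ := ⟨by linarith, by linarith⟩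
  refine ⟨r, φ, ⟨⟨hmotion, (g ρ)⁻¹, (g (-ρ))⁻¹, ?_, fun t => ⟨?_, ?_⟩⟩, hK', hK⟩,
    fun t => ⟨_, hmem (α t), rfl⟩, ?_, ?_⟩
  · intro x hx
    exact (inv_pos.2 (hpos _ hρm)).trans_le hx.1
  · exact inv_anti₀ (hGpos _) (hgmono.monotoneOn (hmem _) hρm (mul_sin_mem_Icc hρ.le _).2)
  · exact inv_anti₀ (hpos _ hρm') (hgmono.monotoneOn hρm' (hmem _) (mul_sin_mem_Icc hρ.le _).1)
  -- At time 0 the phase is 0 and the radial velocity is −Lρ ≠ 0, so the radius is not constant.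
  · rintro ⟨r₀, hcirc⟩
    have h1 : r = fun _ => r₀ := funext hcirc.eq_const
    have h2 := congrFun hrd' 0
    rw [h1, hα0] at h2
    simp at h2
    rcases h2 with h2 | h2
    · exact hL.ne' h2
    · exact hρ.ne' h2
  · rintro ⟨T, hT, hper⟩
    have hcos : Real.cos (α T) = 1 := by
      have h1 : (fun t => r (t + T)) = r := funext fun t => (hper t).1
      have h2 : deriv r (0 + T) = deriv r 0 := by
        rw [← deriv_comp_add_const, h1]
      rw [hrd', zero_add] at h2
      simp only [hα0, Real.cos_zero] at h2
      have h3 : L * ρ * Real.cos (α T) = L * ρ * 1 := neg_injective h2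
      exact mul_left_cancel₀ (mul_pos hL hρ).ne' h3
    obtain ⟨k, hk⟩ := (Real.cos_eq_one_iff _).1 hcos
    have hαmono : StrictMono α := strictMono_of_deriv_pos fun t => by
      rw [(hα t).deriv]; exact inv_pos.2 (hbpos _)
    have hk0 : k ≠ 0 := by
      rintro rfl
      have := hαmono hT
      rw [← hk, hα0] at this
      simp at this
    obtain ⟨n, hn⟩ := Real.Angle.angle_eq_iff_two_pi_dvd_sub.1 (hper 0).2
    have h1 : φ (0 + T) - φ 0 = κ * (k * chartPeriod g ρ) := by
      simp only [hφ, zero_add, hα0, ← hk]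
      have h2 : θ 0 = 0 := by simp [hθ]
      have h3 : θ (k * (2 * Real.pi)) = k * chartPeriod g ρ := by
        have := haper.intervalIntegral_add_zsmul_eq k 0
          (fun _ _ => hac.intervalIntegrable _ _)
        simp only [zsmul_eq_mul, zero_add] at this
        exact this
      rw [h2, h3]
      ring
    rw [h1] at hn
    have hκξ : κ = ξ⁻¹ ∨ κ = -ξ⁻¹ := by
      rcases abs_cases (K / ξ) with ⟨h, -⟩ | ⟨h, -⟩
      · left
        rw [hκ, hLdef, h]
        field_simp
      · right
        rw [hκ, hLdef, h]
        field_simp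
    have hkR : (k : ℝ) ≠ 0 := Int.cast_ne_zero.2 hk0
    rcases hκξ with h | h
    · refine ⟨n / k, ?_⟩
      rw [h] at hn
      push_cast
      field_simp at hn ⊢
      linarith
    · refine ⟨-(n / k), ?_⟩
      rw [h] at hn
      push_cast
      field_simp at hn ⊢
      linarith

end Oscillation

end Revolution

namespace Revolution

/-! ### Closed oscillations have constant period -/

section Period

/-- A countable set of reals is totally disconnected, so a connected image inside it is a single
point. -/
theorem eq_of_continuousOn_of_countable {s : Set ℝ} (hs : IsPreconnected s) {f : ℝ → ℝ}
    (hf : ContinuousOn f s) {C : Set ℝ} (hC : C.Countable) (hfC : MapsTo f s C) {x y : ℝ}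
    (hx : x ∈ s) (hy : y ∈ s) : f x = f y :=
  hC.isTotallyDisconnected (f '' s) hfC.image_subset (hs.image f hf)
    (mem_image_of_mem f hx) (mem_image_of_mem f hy)

theorem chartPeriod_zero (g : ℝ → ℝ) : chartPeriod g 0 = 2 * Real.pi * deriv g 0 := by
  simp [chartPeriod]

/-- The period is continuous in the amplitude down to 0, where it is 2π g'(0); adding this one value
keeps the set of possible periods countable. -/
theorem chartPeriod_eq_of_countable {g : ℝ → ℝ} {δ : ℝ}
    (hg : ContinuousOn (deriv g) (Ioo (-δ) δ)) {C : Set ℝ} (hC : C.Countable)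
    (hgC : ∀ ρ ∈ Ioo 0 δ, chartPeriod g ρ ∈ C) {ρ : ℝ} (hρ : ρ ∈ Ioo 0 δ) :
    chartPeriod g ρ = 2 * Real.pi * deriv g 0 := by
  have hle : -ρ ≤ ρ := by linarith [hρ.1]
  -- The derivative of g is extended from [−ρ, ρ] by constants to a continuous function on ℝ, so
  -- that the parametric integral is continuous on the whole line.
  set h : ℝ → ℝ := IccExtend hle ((Icc (-ρ) ρ).domRestrict (deriv g)) with hh
  have hc : Continuous h := by
    refine Continuous.Icc_extend' ?_
    rw [← continuousOn_iff_continuous_domRestrict]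
    exact hg.mono (Icc_subset_Ioo (by linarith [hρ.2]) hρ.2)
  have hheq : ∀ s ∈ Icc (-ρ) ρ, h s = deriv g s := fun s hs => by
    rw [hh, IccExtend_of_mem _ _ hs]; rfl
  set f : ℝ → ℝ := fun σ => ∫ x in (0 : ℝ)..2 * Real.pi, h (σ * Real.sin x) with hf
  have hfc : Continuous f := by
    refine intervalIntegral.continuous_parametric_intervalIntegral_of_continuous' ?_ _ _
    exact hc.comp (by fun_prop)
  have hfeq : ∀ σ ∈ Icc 0 ρ, f σ = chartPeriod g σ := by
    intro σ hσ
    refine intervalIntegral.integral_congr fun x _ => hheq _ ?_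
    exact Icc_subset_Icc (neg_le_neg hσ.2) hσ.2 (mul_sin_mem_Icc hσ.1 x)
  have := eq_of_continuousOn_of_countable (isPreconnected_Icc (a := 0) (b := ρ)) hfc.continuousOn
    (hC.insert (chartPeriod g 0)) (fun σ hσ => by
      rw [hfeq σ hσ]
      rcases hσ.1.eq_or_lt with h0 | h0
      · rw [← h0]; exact mem_insert _ _
      · exact mem_insert_of_mem _ (hgC σ ⟨h0, hσ.2.trans_lt hρ.2⟩))
    (right_mem_Icc.2 hρ.1.le) (left_mem_Icc.2 hρ.1.le)
  rw [hfeq _ (right_mem_Icc.2 hρ.1.le), hfeq _ (left_mem_Icc.2 hρ.1.le), chartPeriod_zero] at this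
  exact this

/-- The substitution x ↦ 2π − x changes the sign of sin x, so only the even part of h contributes,
and off 0 this exceeds h 0. -/
theorem lt_integral_comp_sin {h : ℝ → ℝ} {η : ℝ} (hη : 0 < η) (hc : ContinuousOn h (Icc (-η) η))
    (hlt : ∀ s ∈ Icc (-η) η, s ≠ 0 → 2 * h 0 < h s + h (-s)) :
    2 * Real.pi * h 0 < ∫ x in (0 : ℝ)..2 * Real.pi, h (η * Real.sin x) := by
  have hm : ∀ x, η * Real.sin x ∈ Icc (-η) η := mul_sin_mem_Icc hη.le
  have hm' : ∀ x, -(η * Real.sin x) ∈ Icc (-η) η := fun x => by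
    have := hm x
    exact ⟨by linarith [this.2], by linarith [this.1]⟩
  have hc1 : Continuous fun x => h (η * Real.sin x) := hc.comp_continuous (by fun_prop) hm
  have hc2 : Continuous fun x => h (-(η * Real.sin x)) := hc.comp_continuous (by fun_prop) hm'
  have hsymm : (∫ x in (0 : ℝ)..2 * Real.pi, h (-(η * Real.sin x))) =
      ∫ x in (0 : ℝ)..2 * Real.pi, h (η * Real.sin x) := by
    have := intervalIntegral.integral_comp_sub_left (a := 0) (b := 2 * Real.pi)
      (fun x => h (η * Real.sin x)) (2 * Real.pi)
    rw [sub_self, sub_zero] at this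
    rw [← this]
    refine intervalIntegral.integral_congr fun x _ => ?_
    rw [Real.sin_two_pi_sub, mul_neg]
  have h1 : (∫ _ in (0 : ℝ)..2 * Real.pi, 2 * h 0) <
      ∫ x in (0 : ℝ)..2 * Real.pi, (h (η * Real.sin x) + h (-(η * Real.sin x))) := by
    refine intervalIntegral.integral_lt_integral_of_continuousOn_of_le_of_exists_lt
      (by positivity) continuousOn_const (hc1.add hc2).continuousOn (fun x _ => ?_)
      ⟨Real.pi / 2, ⟨by positivity, by linarith [Real.pi_pos]⟩, ?_⟩
    · by_cases h0 : η * Real.sin x = 0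
      · rw [h0, neg_zero]; linarith
      · exact (hlt _ (hm x) h0).le
    · refine hlt _ (hm _) ?_
      rw [Real.sin_pi_div_two]
      linarith
  rw [intervalIntegral.integral_add (hc1.intervalIntegrable _ _) (hc2.intervalIntegrable _ _),
    hsymm, intervalIntegral.integral_const, smul_eq_mul, sub_zero] at h1
  linarith

theorem lt_integral_comp_sin_of_deriv2_pos {h : ℝ → ℝ} {δ : ℝ} (hδ : 0 < δ)
    (hh : ContDiffAt ℝ 2 h 0) (h2 : 0 < deriv (deriv h) 0) :
    ∃ η ∈ Ioo 0 δ, 2 * Real.pi * h 0 < ∫ x in (0 : ℝ)..2 * Real.pi, h (η * Real.sin x) := by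
  have hd : ContinuousAt (deriv (deriv h)) 0 :=
    ((hh.derivWithin (m := 1) (by norm_num)).derivWithin (m := 0) (by simp)).continuousAt
  have hev := hd.eventually (lt_mem_nhds h2)
  have hev2 := hh.eventually (by simp)
  obtain ⟨ε, hε, hball⟩ := Metric.eventually_nhds_iff_ball.1 (hev.and hev2)
  rw [Real.ball_eq_Ioo, zero_sub, zero_add] at hball
  set η := min ε δ / 2 with hηd
  have hmin : 0 < min ε δ := lt_min hε hδ
  have hη : 0 < η := by positivity
  have hηε : η < ε := by linarith [min_le_left ε δ]
  have hηδ : η < δ := by linarith [min_le_right ε δ]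
  have hsub : Icc (-η) η ⊆ Ioo (-ε) ε := Icc_subset_Ioo (by linarith) hηε
  have hc : ContinuousOn h (Icc (-η) η) := fun s hs =>
    (hball s (hsub hs)).2.continuousAt.continuousWithinAt
  have hconv : StrictConvexOn ℝ (Icc (-η) η) h :=
    strictConvexOn_of_deriv2_pos (convex_Icc _ _) hc fun x hx =>
      (hball x (hsub (interior_subset hx))).1
  refine ⟨η, ⟨hη, hηδ⟩, lt_integral_comp_sin hη hc fun s hs hs0 => ?_⟩
  have hs' : -s ∈ Icc (-η) η := ⟨by linarith [hs.2], by linarith [hs.1]⟩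
  have := hconv.2 hs hs' (fun h => hs0 (by linarith)) (show (0 : ℝ) < 1 / 2 by norm_num)
    (show (0 : ℝ) < 1 / 2 by norm_num) (by norm_num)
  simp only [smul_eq_mul] at this
  rw [show (1 / 2 * s + 1 / 2 * -s : ℝ) = 0 by ring] at this
  linarith

/-- If all small oscillations have the same period, the third derivative of the chart vanishes. -/
theorem deriv3_eq_zero_of_chartPeriod {g : ℝ → ℝ} {δ : ℝ} (hδ : 0 < δ)
    (hg : ContDiffAt ℝ 3 g 0)
    (hconst : ∀ ρ ∈ Ioo 0 δ, chartPeriod g ρ = 2 * Real.pi * deriv g 0) :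
    deriv (deriv (deriv g)) 0 = 0 := by
  have h1 : ContDiffAt ℝ 2 (deriv g) 0 := hg.derivWithin (by norm_num)
  rcases lt_trichotomy (deriv (deriv (deriv g)) 0) 0 with h | h | h
  · have hneg : 0 < deriv (deriv (-deriv g)) 0 := by
      have e1 : deriv (-deriv g) = -deriv (deriv g) := by
        funext x; exact deriv.neg
      rw [e1, deriv.neg]
      linarith
    obtain ⟨η, hη, hlt⟩ := lt_integral_comp_sin_of_deriv2_pos hδ h1.neg hneg
    simp only [intervalIntegral.integral_neg] at hlt
    have := hconst η hη
    rw [chartPeriod] at this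
    linarith
  · exact h
  · obtain ⟨η, hη, hlt⟩ := lt_integral_comp_sin_of_deriv2_pos hδ h1 h
    have := hconst η hη
    rw [chartPeriod] at this
    linarith

end Period

/-! ### The third-order condition on an isochronous force. -/

section ThirdOrder

/-- The relation between the derivatives of a force at its zero when the third derivative of the
chart vanishes. -/
theorem three_mul_deriv_mul_deriv3 {g F F₁ F₂ : ℝ → ℝ} {c F₃ : ℝ} (hg : ContDiffAt ℝ 4 g 0)
    (hg0 : g 0 = c) (hg1 : deriv g 0 ≠ 0) (hg3 : deriv (deriv (deriv g)) 0 = 0)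
    (hrel : ∀ᶠ s in 𝓝 0, deriv g s * F (g s) = s)
    (hFc : F c = 0) (hF : ∀ᶠ u in 𝓝 c, HasDerivAt F (F₁ u) u)
    (hF₁ : ∀ᶠ u in 𝓝 c, HasDerivAt F₁ (F₂ u) u) (hF₂ : HasDerivAt F₂ F₃ c) :
    3 * F₁ c * F₃ = 5 * F₂ c ^ 2 := by
  set g₁ := deriv g with hg₁
  set g₂ := deriv g₁ with hg₂
  set g₃ := deriv g₂ with hg₃
  have c1 : ContDiffAt ℝ 3 g₁ 0 := hg.derivWithin (by norm_num)
  have c2 : ContDiffAt ℝ 2 g₂ 0 := c1.derivWithin (by norm_num)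
  have c3 : ContDiffAt ℝ 1 g₃ 0 := c2.derivWithin (by norm_num)
  have d0 : ∀ᶠ s in 𝓝 0, HasDerivAt g (g₁ s) s := (hg.eventually (by simp)).mono fun s hs =>
    (hs.differentiableAt (by simp)).hasDerivAt
  have d1 : ∀ᶠ s in 𝓝 0, HasDerivAt g₁ (g₂ s) s := (c1.eventually (by simp)).mono fun s hs =>
    (hs.differentiableAt (by simp)).hasDerivAt
  have d2 : ∀ᶠ s in 𝓝 0, HasDerivAt g₂ (g₃ s) s := (c2.eventually (by simp)).mono fun s hs =>
    (hs.differentiableAt (by simp)).hasDerivAt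
  have d3 : HasDerivAt g₃ (deriv g₃ 0) 0 := (c3.differentiableAt (by simp)).hasDerivAt
  have hgc : Tendsto g (𝓝 0) (𝓝 c) := by
    have := hg.continuousAt.tendsto
    rwa [hg0] at this
  -- `e1`, `e2` and `e3` are the first three derivatives of g'(s) F(g(s)) = s, the last one taken at
  -- 0 only, where F(c) = 0 and g'''(0) = 0 remove most terms.
  have e1 : ∀ᶠ s in 𝓝 0, g₂ s * F (g s) + g₁ s ^ 2 * F₁ (g s) = 1 := by
    filter_upwards [hrel.eventually_nhds, d0, d1, hgc.eventually hF] with s h1 h2 h3 h4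
    have h5 := (h3.mul (h4.comp s h2)).unique ((hasDerivAt_id s).congr_of_eventuallyEq h1)
    simp only [Function.comp] at h5
    linear_combination h5
  have e2 : ∀ᶠ s in 𝓝 0, g₃ s * F (g s) + 3 * g₁ s * g₂ s * F₁ (g s) + g₁ s ^ 3 * F₂ (g s) = 0 := by
    filter_upwards [e1.eventually_nhds, d0, d1, d2, hgc.eventually hF, hgc.eventually hF₁]
      with s h1 h2 h3 h4 h5 h6
    have h7 := ((h4.mul (h5.comp s h2)).add ((h3.pow 2).mul (h6.comp s h2))).unique
      ((hasDerivAt_const s (1 : ℝ)).congr_of_eventuallyEq h1)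
    simp only [Function.comp, Pi.pow_apply] at h7
    norm_num at h7
    linear_combination h7
  have e2' := e2.self_of_nhds
  have h0 := d0.self_of_nhds
  have h1 := d1.self_of_nhds
  have h2 := d2.self_of_nhds
  have f0 := hF.self_of_nhds
  have f1 := hF₁.self_of_nhds
  rw [← hg0] at f0 f1 hF₂
  have e3 := (((d3.mul (f0.comp 0 h0)).add (((h1.const_mul 3).mul h2).mul (f1.comp 0 h0))).add
    ((h1.pow 3).mul (hF₂.comp 0 h0))).unique
      ((hasDerivAt_const (0 : ℝ) (0 : ℝ)).congr_of_eventuallyEq e2)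
  simp only [Function.comp, Pi.pow_apply, Pi.mul_apply, hg0, hFc, hg3] at e3 e2'
  norm_num at e3 e2'
  set x := g₁ 0
  set y := g₂ 0
  set a := F₁ c
  set b := F₂ c
  -- The second-order relation determines g''(0); substituting it in the third-order one leaves
  -- derivatives of F alone.
  have h5 : 3 * y * a = -(x ^ 2 * b) := by
    apply mul_left_cancel₀ hg1
    linear_combination e2'
  have h6 : x ^ 4 * (3 * a * F₃ - 5 * b ^ 2) = 0 := by
    linear_combination (3 * a) * e3 + (-5 * x^2 * b - 3 * y * a) * h5
  rcases mul_eq_zero.1 h6 with h7 | h7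
  · exact absurd (pow_eq_zero_iff (by norm_num) |>.1 h7) hg1
  · linarith

end ThirdOrder

end Revolution

namespace Revolution

/-! ### Potentials near a strongly stable circle with closed nearby orbits -/

section InverseRadius

variable {V : ℝ → ℝ}

theorem hasDerivAt_inverseRadiusPotential (hV : ContDiffOn ℝ ∞ V (Ioi 0)) (L : ℝ) {u : ℝ}
    (hu : 0 < u) :
    HasDerivAt (fun u => u ^ 2 / 2 + V u⁻¹ / L ^ 2) (inverseRadiusForce V L u) u := by
  have h1 := (hasDerivAt_of_contDiffOn_Ioi hV (inv_pos.2 hu)).comp u (hasDerivAt_inv hu.ne')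
  refine (((hasDerivAt_pow 2 u).div_const 2).add (h1.div_const (L ^ 2))).congr_deriv ?_
  rw [deriv_eq_circularMomentumSq_div V (inv_pos.2 hu), inverseRadiusForce]
  field_simp
  ring

theorem hasDerivAt_inverseRadiusForce (hV : ContDiffOn ℝ ∞ V (Ioi 0)) (L : ℝ) {u : ℝ}
    (hu : 0 < u) :
    HasDerivAt (inverseRadiusForce V L)
      (1 - circularMomentumSq V u⁻¹ / L ^ 2 +
        u⁻¹ * deriv (circularMomentumSq V) u⁻¹ / L ^ 2) u := by
  have h1 := (hasDerivAt_circularMomentumSq hV (inv_pos.2 hu)).comp u (hasDerivAt_inv hu.ne')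
  refine ((hasDerivAt_id u).mul ((h1.div_const (L ^ 2)).const_sub 1)).congr_deriv ?_
  simp only [Function.comp, id]
  field_simp

theorem inverseRadiusForce_inv {L r : ℝ} (hL : L ≠ 0) (hLr : L ^ 2 = circularMomentumSq V r) :
    inverseRadiusForce V L r⁻¹ = 0 := by
  have : L ^ 2 ≠ 0 := pow_ne_zero 2 hL
  rw [inverseRadiusForce, inv_inv, ← hLr, div_self this, sub_self, mul_zero]

/-- The number β is the frequency, per unit of ξφ, of infinitesimal oscillations about the circle:
β² = rG'(r)/G(r). -/
theorem hasDerivAt_inverseRadiusForce_inv (hV : ContDiffOn ℝ ∞ V (Ioi 0)) {L r β : ℝ}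
    (hL : L ≠ 0) (hr : 0 < r) (hLr : L ^ 2 = circularMomentumSq V r)
    (hβ : β ^ 2 = r * deriv (circularMomentumSq V) r / circularMomentumSq V r) :
    HasDerivAt (inverseRadiusForce V L) (β ^ 2) r⁻¹ := by
  have : L ^ 2 ≠ 0 := pow_ne_zero 2 hL
  refine (hasDerivAt_inverseRadiusForce hV L (inv_pos.2 hr)).congr_deriv ?_
  rw [inv_inv, hβ, ← hLr, div_self this, sub_self, zero_add]

theorem contDiffAt_sqrtCoordinate_inverseRadius (hV : ContDiffOn ℝ ∞ V (Ioi 0)) {L r β : ℝ}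
    (hL : L ≠ 0) (hr : 0 < r) (hLr : L ^ 2 = circularMomentumSq V r) (hβ0 : 0 < β)
    (hβ : β ^ 2 = r * deriv (circularMomentumSq V) r / circularMomentumSq V r) :
    ContDiffAt ℝ 1 (sqrtCoordinate (fun u => u ^ 2 / 2 + V u⁻¹ / L ^ 2) r⁻¹) r⁻¹ := by
  refine contDiffAt_sqrtCoordinate hβ0 ?_ (inverseRadiusForce_inv hL hLr) ?_
    (hasDerivAt_inverseRadiusForce_inv hV hL hr hLr hβ)
  · filter_upwards [Ioi_mem_nhds (inv_pos.2 hr)] with u hu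
    exact hasDerivAt_inverseRadiusPotential hV L hu
  · filter_upwards [Ioi_mem_nhds (inv_pos.2 hr)] with u hu
    exact (hasDerivAt_inverseRadiusForce hV L hu).continuousAt

end InverseRadius

section Local

variable {ξ : ℝ} {V : ℝ → ℝ}

theorem inv_mem_nhds_inv {r : ℝ} (hr : 0 < r) {N : Set ℝ} (hN : N ∈ 𝓝 r) :
    {u : ℝ | 0 < u ∧ u⁻¹ ∈ N} ∈ 𝓝 r⁻¹ := by
  have h1 : Tendsto (fun u : ℝ => u⁻¹) (𝓝 r⁻¹) (𝓝 r) := by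
    have := (continuousAt_inv₀ (inv_pos.2 hr).ne').tendsto
    rwa [inv_inv] at this
  exact inter_mem (Ioi_mem_nhds (inv_pos.2 hr)) (h1 hN)

/-- Near a strongly stable circle there are noncircular nonsingular bounded orbits with the same
angular momentum. -/
theorem exists_noncircular (hξ : 0 < ξ) (hV : ContDiffOn ℝ ∞ V (Ioi 0)) {r₀ K : ℝ}
    (hr₀ : 0 < r₀) (hK0 : K ≠ 0) (hK : (K / ξ) ^ 2 = circularMomentumSq V r₀)
    (hpos : 0 < deriv (circularMomentumSq V) r₀) {N : Set ℝ} (hN : N ∈ 𝓝 r₀) :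
    ∃ r φ, IsNonsingularBounded (Ioi 0) (coneProfile ξ) V r φ K ∧ (∀ t, r t ∈ N) ∧
      ¬ OrbitIsCircular r φ := by
  have hL : K / ξ ≠ 0 := div_ne_zero hK0 hξ.ne'
  have hG : 0 < circularMomentumSq V r₀ := by rw [← hK]; positivity
  set β := √(r₀ * deriv (circularMomentumSq V) r₀ / circularMomentumSq V r₀) with hβdef
  have hβ0 : 0 < β := Real.sqrt_pos.2 (by positivity)
  have hβ : β ^ 2 = r₀ * deriv (circularMomentumSq V) r₀ / circularMomentumSq V r₀ :=
    Real.sq_sqrt (by positivity)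
  obtain ⟨g, δ, hg, -, hgN, -⟩ := exists_isMinChart hβ0
    (by
      filter_upwards [Ioi_mem_nhds (inv_pos.2 hr₀)] with u hu
      exact hasDerivAt_inverseRadiusPotential hV (K / ξ) hu)
    (inverseRadiusForce_inv hL hK) (hasDerivAt_inverseRadiusForce_inv hV hL hr₀ hK hβ) le_rfl
    (contDiffAt_sqrtCoordinate_inverseRadius hV hL hr₀ hK hβ0 hβ) (inv_mem_nhds_inv hr₀ hN)
  obtain ⟨r, φ, h1, h2, h3, -⟩ := exists_oscillation hξ hK0 hg (fun s hs => (hgN s hs).1)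
    (half_pos hg.pos) (half_lt_self hg.pos)
  refine ⟨r, φ, h1, fun t => ?_, h3⟩
  obtain ⟨s, hs, hst⟩ := h2 t
  rw [hst]
  exact (hgN s hs).2

/-- All oscillations in the chart stay in N, so they close up and their periods lie in 2πξℚ. A
continuous function with countably many values is constant, so every period equals the limit 2π/β,
and 1/β is in ξℚ. The potential U is free up to its derivative, so that a more regular primitive can
be supplied where one is known. -/
theorem exists_chart_of_closed (hξ : 0 < ξ) (hV : ContDiffOn ℝ ∞ V (Ioi 0)) {r₁ K : ℝ}
    (hr₁ : 0 < r₁) (hK0 : K ≠ 0) (hK : (K / ξ) ^ 2 = circularMomentumSq V r₁) {β : ℝ}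
    (hβ0 : 0 < β) (hβ : β ^ 2 = r₁ * deriv (circularMomentumSq V) r₁ / circularMomentumSq V r₁)
    {N : Set ℝ} (hN : N ∈ 𝓝 r₁)
    (hclosed : ∀ r φ, IsNonsingularBounded (Ioi 0) (coneProfile ξ) V r φ K →
      (∀ t, r t ∈ N) → OrbitIsClosed r φ)
    {U : ℝ → ℝ} (hU : ∀ᶠ u in 𝓝 r₁⁻¹, HasDerivAt U (inverseRadiusForce V (K / ξ) u) u)
    {n : WithTop ℕ∞} (hn : 1 ≤ n) (hσ : ContDiffAt ℝ n (sqrtCoordinate U r₁⁻¹) r₁⁻¹) :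
    ∃ g δ, IsMinChart (inverseRadiusForce V (K / ξ)) r₁⁻¹ δ g ∧ deriv g 0 = 1 / β ∧
      ContDiffAt ℝ n g 0 ∧ (∀ ρ ∈ Ioo 0 δ, chartPeriod g ρ = 2 * Real.pi * deriv g 0) ∧
      ∃ q : ℚ, 1 / β = ξ * q := by
  have hL : K / ξ ≠ 0 := div_ne_zero hK0 hξ.ne'
  obtain ⟨g, δ, hg, hgβ, hgN, hgn⟩ := exists_isMinChart hβ0 hU
    (inverseRadiusForce_inv hL hK) (hasDerivAt_inverseRadiusForce_inv hV hL hr₁ hK hβ) hn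
    hσ (inv_mem_nhds_inv hr₁ hN)
  have hq : ∀ ρ ∈ Ioo 0 δ, ∃ q : ℚ, chartPeriod g ρ = 2 * Real.pi * ξ * q := by
    intro ρ hρ
    obtain ⟨r, φ, h1, h2, -, h4⟩ := exists_oscillation hξ hK0 hg (fun s hs => (hgN s hs).1)
      hρ.1 hρ.2
    refine h4 (hclosed r φ h1 fun t => ?_)
    obtain ⟨s, hs, hst⟩ := h2 t
    rw [hst]
    exact (hgN s hs).2
  have hconst : ∀ ρ ∈ Ioo 0 δ, chartPeriod g ρ = 2 * Real.pi * deriv g 0 := fun ρ hρ =>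
    chartPeriod_eq_of_countable hg.continuousOn
      (countable_range fun q : ℚ => 2 * Real.pi * ξ * q)
      (fun σ hσ => by obtain ⟨q, h⟩ := hq σ hσ; exact ⟨q, h.symm⟩) hρ
  refine ⟨g, δ, hg, hgβ, hgn, hconst, ?_⟩
  have hmem : δ / 2 ∈ Ioo 0 δ := ⟨half_pos hg.pos, half_lt_self hg.pos⟩
  obtain ⟨q, h⟩ := hq _ hmem
  refine ⟨q, ?_⟩
  rw [hconst _ hmem, hgβ] at h
  exact mul_left_cancel₀ (mul_ne_zero two_ne_zero Real.pi_ne_zero) (by rw [h, mul_assoc])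

/-- The angular period of small oscillations is locally constant. -/
theorem eventually_circularMomentumSq_eq_rpow (hξ : 0 < ξ) (hV : ContDiffOn ℝ ∞ V (Ioi 0))
    {r₀ K₀ : ℝ} (hr₀ : 0 < r₀) (hK0 : K₀ ≠ 0) (hK : (K₀ / ξ) ^ 2 = circularMomentumSq V r₀)
    (hpos : 0 < deriv (circularMomentumSq V) r₀)
    (hnear : NearbyOrbitsClosed (Ioi 0) (coneProfile ξ) V r₀ K₀) :
    ∃ A β : ℝ, 0 < A ∧ 0 < β ∧ (∃ q : ℚ, 1 / β = ξ * q) ∧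
      ∀ᶠ r in 𝓝 r₀, circularMomentumSq V r = A * r ^ (β ^ 2) := by
  obtain ⟨ε, hε, hnear⟩ := hnear
  set G := circularMomentumSq V with hG
  have hGpos : 0 < G r₀ := by rw [← hK]; have := div_ne_zero hK0 hξ.ne'; positivity
  have hGs := contDiffOn_circularMomentumSq hV
  have hGc : ContinuousOn G (Ioi 0) := hGs.continuousOn
  have hG'c : ContinuousOn (deriv G) (Ioi 0) := (contDiffOn_deriv_Ioi hGs).continuousOn
  -- κ(r) is the angular momentum of the circle of radius r with the sign of K₀; near r₀ it stays in
  -- the window (K₀ − ε, K₀ + ε).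
  set κ : ℝ → ℝ := fun r => K₀ * √(G r / G r₀) with hκ
  have hκr₀ : κ r₀ = K₀ := by simp [hκ, hGpos.ne']
  have hκc : ContinuousAt κ r₀ :=
    continuousAt_const.mul ((hGc.continuousAt (Ioi_mem_nhds hr₀)).div_const _).sqrt
  have hev : ∀ᶠ r in 𝓝 r₀, (0 < r ∧ r ∈ Ioo (r₀ - ε) (r₀ + ε)) ∧ (0 < G r ∧ 0 < deriv G r) ∧
      κ r ∈ Ioo (K₀ - ε) (K₀ + ε) := by
    refine (Eventually.and ?_ ?_).and (Eventually.and ?_ ?_ |>.and ?_)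
    · exact lt_mem_nhds hr₀
    · exact Ioo_mem_nhds (by linarith) (by linarith)
    · exact (hGc.continuousAt (Ioi_mem_nhds hr₀)).eventually (lt_mem_nhds hGpos)
    · exact (hG'c.continuousAt (Ioi_mem_nhds hr₀)).eventually (lt_mem_nhds hpos)
    · exact hκc.eventually (Ioo_mem_nhds (by rw [hκr₀]; linarith) (by rw [hκr₀]; linarith))
  obtain ⟨η, hη, hball⟩ := Metric.eventually_nhds_iff_ball.1 hev
  set B := Metric.ball r₀ η with hB
  have hr₀B : r₀ ∈ B := Metric.mem_ball_self hη
  have hBpre : IsPreconnected B := (convex_ball r₀ η).isPreconnected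
  set b : ℝ → ℝ := fun r => √(r * deriv G r / G r) with hb
  have hbpos : ∀ r ∈ B, 0 < b r := fun r hr => by
    obtain ⟨⟨h1, -⟩, ⟨h2, h3⟩, -⟩ := hball r hr
    exact Real.sqrt_pos.2 (by positivity)
  have hbsq : ∀ r ∈ B, b r ^ 2 = r * deriv G r / G r := fun r hr => by
    obtain ⟨⟨h1, -⟩, ⟨h2, h3⟩, -⟩ := hball r hr
    exact Real.sq_sqrt (by positivity)
  have hrat : ∀ r ∈ B, ∃ q : ℚ, 1 / b r = ξ * q := by
    intro r hr
    obtain ⟨⟨h1, h2⟩, ⟨h3, h4⟩, h5⟩ := hball r hr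
    have hκ0 : κ r ≠ 0 := mul_ne_zero hK0 (Real.sqrt_pos.2 (by positivity)).ne'
    have hκsq : (κ r / ξ) ^ 2 = G r := by
      have : (κ r / ξ) ^ 2 = (K₀ / ξ) ^ 2 * (G r / G r₀) := by
        simp only [hκ]
        rw [mul_div_right_comm, mul_pow, Real.sq_sqrt (by positivity)]
      rw [this, hK]
      field_simp
    obtain ⟨-, -, -, -, -, -, h⟩ := exists_chart_of_closed hξ hV h1 hκ0 hκsq (hbpos r hr)
      (hbsq r hr) (Icc_mem_nhds h2.1 h2.2) (fun ρ φ hρ hm => hnear ρ φ _ hρ hm h5)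
      (by
        filter_upwards [Ioi_mem_nhds (inv_pos.2 h1)] with u hu
        exact hasDerivAt_inverseRadiusPotential hV _ hu) le_rfl
      (contDiffAt_sqrtCoordinate_inverseRadius hV (div_ne_zero hκ0 hξ.ne') h1 hκsq (hbpos r hr)
        (hbsq r hr))
    exact h
  have hbc : ContinuousOn (fun r => 1 / b r) B := by
    refine continuousOn_const.div ?_ fun r hr => (hbpos r hr).ne'
    intro r hr
    obtain ⟨⟨h1, -⟩, ⟨h2, h3⟩, -⟩ := hball r hr
    exact ((continuousAt_id.mul (hG'c.continuousAt (Ioi_mem_nhds h1))).div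
      (hGc.continuousAt (Ioi_mem_nhds h1)) h2.ne').sqrt.continuousWithinAt
  -- 1/b is continuous with values in the countable set ξℚ.
  have hbconst : ∀ r ∈ B, b r = b r₀ := by
    intro r hr
    have := eq_of_continuousOn_of_countable hBpre hbc
      (countable_range fun q : ℚ => ξ * q) (fun x hx => by
        obtain ⟨q, h⟩ := hrat x hx; exact ⟨q, h.symm⟩) hr hr₀B
    simpa using this
  set β := b r₀ with hβ
  -- With b constant, rG' = β²G, whose solutions are multiples of r^(β²).
  have hd : ∀ r ∈ B, HasDerivAt (fun r => G r * r ^ (-β ^ 2)) 0 r := by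
    intro r hr
    obtain ⟨⟨h1, -⟩, ⟨h2, h3⟩, -⟩ := hball r hr
    refine ((hasDerivAt_circularMomentumSq hV h1).mul
      (Real.hasDerivAt_rpow_const (p := -β ^ 2) (Or.inl h1.ne'))).congr_deriv ?_
    have h4 := hbsq r hr
    rw [hbconst r hr] at h4
    have h5 : r * deriv G r = β ^ 2 * G r := by rw [h4]; field_simp
    rw [← hG, Real.rpow_sub_one h1.ne']
    field_simp
    linear_combination r ^ (-β ^ 2) * h5
  have hconst : ∀ r ∈ B, G r * r ^ (-β ^ 2) = G r₀ * r₀ ^ (-β ^ 2) := fun r hr =>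
    Metric.isOpen_ball.is_const_of_deriv_eq_zero hBpre
      (fun x hx => (hd x hx).differentiableAt.differentiableWithinAt)
      (fun x hx => (hd x hx).deriv) hr hr₀B
  refine ⟨G r₀ * r₀ ^ (-β ^ 2), β, by positivity, hbpos r₀ hr₀B, hrat r₀ hr₀B, ?_⟩
  filter_upwards [Metric.ball_mem_nhds r₀ hη] with r hr
  obtain ⟨⟨h1, -⟩, -⟩ := hball r hr
  rw [← hconst r hr, mul_assoc, ← Real.rpow_add h1, neg_add_cancel, Real.rpow_zero, mul_one]

end Local

end Revolution

namespace Revolution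

/-! ### Power-law forces and the admissible exponents. -/

section PowerForce

theorem hasDerivAt_powerForce (κ b : ℝ) {u : ℝ} (hu : 0 < u) :
    HasDerivAt (fun u : ℝ => u - κ * u ^ (1 - b)) (1 - κ * (1 - b) * u ^ (-b)) u := by
  refine ((hasDerivAt_id u).sub
    ((Real.hasDerivAt_rpow_const (p := 1 - b) (Or.inl hu.ne')).const_mul κ)).congr_deriv ?_
  rw [show 1 - b - 1 = -b by ring]
  ring

theorem hasDerivAt_powerForce₁ (κ b : ℝ) {u : ℝ} (hu : 0 < u) :
    HasDerivAt (fun u : ℝ => 1 - κ * (1 - b) * u ^ (-b)) (κ * (1 - b) * b * u ^ (-b - 1)) u := by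
  refine (((Real.hasDerivAt_rpow_const (p := -b) (Or.inl hu.ne')).const_mul
    (κ * (1 - b))).const_sub 1).congr_deriv ?_
  ring

theorem hasDerivAt_powerForce₂ (κ b : ℝ) {u : ℝ} (hu : 0 < u) :
    HasDerivAt (fun u : ℝ => κ * (1 - b) * b * u ^ (-b - 1))
      (-(κ * (1 - b) * b * (b + 1) * u ^ (-b - 2))) u := by
  refine ((Real.hasDerivAt_rpow_const (p := -b - 1) (Or.inl hu.ne')).const_mul
    (κ * (1 - b) * b)).congr_deriv ?_
  rw [show -b - 1 - 1 = -b - 2 by ring]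
  ring

/-- An explicit analytic primitive is wanted to obtain a C⁴ chart; the case b = 2 is separate
because its primitive is a logarithm. -/
theorem exists_analyticAt_powerPotential (κ b : ℝ) {c : ℝ} (hc : 0 < c) :
    ∃ U : ℝ → ℝ, AnalyticAt ℝ U c ∧ ∀ u, 0 < u → HasDerivAt U (u - κ * u ^ (1 - b)) u := by
  obtain ⟨ψ, hψa, hψ⟩ : ∃ ψ : ℝ → ℝ, AnalyticAt ℝ ψ c ∧
      ∀ u, 0 < u → HasDerivAt ψ (u ^ (1 - b)) u := by
    rcases eq_or_ne b 2 with rfl | hb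
    · refine ⟨Real.log, analyticAt_log hc, fun u hu => ?_⟩
      refine (Real.hasDerivAt_log hu.ne').congr_deriv ?_
      rw [show (1 - 2 : ℝ) = -1 by norm_num, Real.rpow_neg_one]
    · have hb' : 2 - b ≠ 0 := sub_ne_zero.2 hb.symm
      refine ⟨fun u => u ^ (2 - b) / (2 - b), ?_, fun u hu => ?_⟩
      · exact ((Real.contDiffAt_rpow_const_of_ne hc.ne').div_const _).analyticAt
      · refine ((Real.hasDerivAt_rpow_const (p := 2 - b) (Or.inl hu.ne')).div_const
          (2 - b)).congr_deriv ?_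
        rw [show 2 - b - 1 = 1 - b by ring]
        field_simp
  refine ⟨fun u => u ^ 2 / 2 - κ * ψ u, ?_, fun u hu => ?_⟩
  · exact ((analyticAt_id.pow 2).div analyticAt_const two_ne_zero).sub
      (analyticAt_const.mul hψa)
  · refine (((hasDerivAt_pow 2 u).div_const 2).sub ((hψ u hu).const_mul κ)).congr_deriv ?_
    simp

end PowerForce

section Exponent

variable {ξ : ℝ} {V : ℝ → ℝ}

/-- The exponent of a power-law force near a circle with closed nearby orbits. -/
theorem exponent_eq_one_or_two (hξ : 0 < ξ) (hV : ContDiffOn ℝ ∞ V (Ioi 0))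
    {r₀ K₀ : ℝ} (hr₀ : 0 < r₀) (hK0 : K₀ ≠ 0) (hK : (K₀ / ξ) ^ 2 = circularMomentumSq V r₀)
    (hnear : NearbyOrbitsClosed (Ioi 0) (coneProfile ξ) V r₀ K₀)
    {A β : ℝ} (hA : 0 < A) (hβ : 0 < β)
    (hG : ∀ᶠ r in 𝓝 r₀, circularMomentumSq V r = A * r ^ (β ^ 2)) : β = 1 ∨ β = 2 := by
  obtain ⟨ε, hε, hnear⟩ := hnear
  set c := r₀⁻¹ with hc
  have hcpos : 0 < c := inv_pos.2 hr₀
  set b := β ^ 2 with hb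
  have hbpos : 0 < b := by positivity
  have hG0 := hG.self_of_nhds
  have hG'0 : deriv (circularMomentumSq V) r₀ = A * (b * r₀ ^ (b - 1)) := by
    have h1 : HasDerivAt (fun r : ℝ => A * r ^ b) (A * (b * r₀ ^ (b - 1))) r₀ :=
      (Real.hasDerivAt_rpow_const (Or.inl hr₀.ne')).const_mul A
    exact (h1.congr_of_eventuallyEq hG).deriv
  have hβsq : β ^ 2 = r₀ * deriv (circularMomentumSq V) r₀ / circularMomentumSq V r₀ := by
    rw [hG'0, hG0, Real.rpow_sub_one hr₀.ne']
    have : r₀ ^ b ≠ 0 := (Real.rpow_pos_of_pos hr₀ b).ne'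
    field_simp
    exact hb.symm
  set L := K₀ / ξ with hL
  have hL2 : 0 < L ^ 2 := by rw [hK, hG0]; positivity
  -- With this κ the force is u − κu^(1−b), and κc^(−b) = 1 expresses that it vanishes at c = 1/r₀.
  set κ := A / L ^ 2 with hκ
  have hκc : κ * c ^ (-b) = 1 := by
    rw [hκ, hc, Real.inv_rpow hr₀.le, ← Real.rpow_neg hr₀.le, neg_neg, hK, hG0]
    have : r₀ ^ b ≠ 0 := (Real.rpow_pos_of_pos hr₀ b).ne'
    field_simp
  have hforce : ∀ᶠ u in 𝓝 c, inverseRadiusForce V L u = u - κ * u ^ (1 - b) := by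
    filter_upwards [inv_mem_nhds_inv hr₀ hG] with u hu
    have h1 : circularMomentumSq V u⁻¹ = A * u⁻¹ ^ b := hu.2
    have h2 : u ^ b ≠ 0 := (Real.rpow_pos_of_pos hu.1 b).ne'
    rw [inverseRadiusForce, h1, Real.inv_rpow hu.1.le, Real.rpow_sub hu.1, Real.rpow_one, hκ]
    field_simp
  obtain ⟨U, hUa, hUd⟩ := exists_analyticAt_powerPotential κ b hcpos
  have hU : ∀ᶠ u in 𝓝 c, HasDerivAt U (inverseRadiusForce V L u) u := by
    filter_upwards [hforce, Ioi_mem_nhds hcpos] with u hu hu0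
    rw [hu]
    exact hUd u hu0
  have hL0 : L ≠ 0 := fun h => by simp [h] at hL2
  obtain ⟨g, δ, hg, -, hgn, hconst, -⟩ := exists_chart_of_closed (n := 4) hξ hV hr₀ hK0 hK hβ
    hβsq (Icc_mem_nhds (by linarith : r₀ - ε < r₀) (by linarith : r₀ < r₀ + ε))
    (fun ρ φ hρ hm => hnear ρ φ _ hρ hm ⟨by linarith, by linarith⟩) hU (by norm_num)
    (contDiffAt_sqrtCoordinate_of_analyticAt hβ hUa hU (inverseRadiusForce_inv hL0 hK)
      (hasDerivAt_inverseRadiusForce_inv hV hL0 hr₀ hK hβsq))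
  have h0mem : (0 : ℝ) ∈ Ioo (-δ) δ := ⟨by linarith [hg.pos], hg.pos⟩
  have hg3 := deriv3_eq_zero_of_chartPeriod hg.pos (hgn.of_le (by norm_num)) hconst
  have hrel : ∀ᶠ s in 𝓝 0, deriv g s * (g s - κ * g s ^ (1 - b)) = s := by
    have hgc : Tendsto g (𝓝 0) (𝓝 c) := by
      have := hgn.continuousAt.tendsto
      rwa [hg.map_zero] at this
    filter_upwards [hgc.eventually hforce, Ioo_mem_nhds h0mem.1 h0mem.2] with s h1 h2
    rw [← h1]
    exact hg.deriv_mul s h2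
  have hpos := Ioi_mem_nhds hcpos
  have key := three_mul_deriv_mul_deriv3 (F := fun u => u - κ * u ^ (1 - b)) hgn hg.map_zero
    (hg.deriv_pos 0 h0mem).ne' hg3 hrel
    (by rw [Real.rpow_sub hcpos, Real.rpow_one, ← mul_div_assoc, mul_comm κ, mul_div_assoc,
          div_eq_mul_inv, ← Real.rpow_neg hcpos.le, hκc]; ring)
    (by filter_upwards [hpos] with u hu using hasDerivAt_powerForce κ b hu)
    (by filter_upwards [hpos] with u hu using hasDerivAt_powerForce₁ κ b hu)
    (hasDerivAt_powerForce₂ κ b hcpos)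
  have e1 : κ * (1 - b) * c ^ (-b) = 1 - b := by linear_combination (1 - b) * hκc
  have e2 : κ * (1 - b) * b * c ^ (-b - 1) = (1 - b) * b / c := by
    rw [Real.rpow_sub hcpos, Real.rpow_one]
    field_simp
    linear_combination (1 - b) * hκc
  have e3 : κ * (1 - b) * b * (b + 1) * c ^ (-b - 2) = (1 - b) * b * (b + 1) / c ^ 2 := by
    rw [Real.rpow_sub hcpos, Real.rpow_two]
    field_simp
    linear_combination (1 - b) * hκc
  rw [e1, e2, e3] at key
  field_simp at key
  -- At c the force has derivatives b, (1−b)b/c and −(1−b)b(b+1)/c². The third-order relation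
  -- 3F'F''' = 5F''² then amounts to b²(1−b)(4−b) = 0.
  have h5 : (1 - b) * (4 - b) = 0 := by
    apply mul_left_cancel₀ hbpos.ne'
    linear_combination (-1 / 2) * key
  rcases mul_eq_zero.1 h5 with h | h
  · left
    nlinarith
  · right
    nlinarith

/-- The local form of Bertrand's theorem on the cone. -/
theorem circularMomentumSq_eq_near (hξ : 0 < ξ) (hV : ContDiffOn ℝ ∞ V (Ioi 0))
    {r₀ K₀ : ℝ} (hr₀ : 0 < r₀) (hK0 : K₀ ≠ 0) (hK : (K₀ / ξ) ^ 2 = circularMomentumSq V r₀)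
    (hpos : 0 < deriv (circularMomentumSq V) r₀)
    (hnear : NearbyOrbitsClosed (Ioi 0) (coneProfile ξ) V r₀ K₀) :
    ¬ Irrational ξ ∧ ∃ i : ℕ, (i = 1 ∨ i = 2) ∧ ∃ A : ℝ, 0 < A ∧
      ∀ᶠ r in 𝓝 r₀, circularMomentumSq V r = A * r ^ (i ^ 2) := by
  obtain ⟨A, β, hA, hβ, ⟨q, hq⟩, hG⟩ :=
    eventually_circularMomentumSq_eq_rpow hξ hV hr₀ hK0 hK hpos hnear
  have hβi : ∃ i : ℕ, (i = 1 ∨ i = 2) ∧ β = i := by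
    rcases exponent_eq_one_or_two hξ hV hr₀ hK0 hK hnear hA hβ hG with h | h
    · exact ⟨1, Or.inl rfl, by simpa using h⟩
    · exact ⟨2, Or.inr rfl, by simpa using h⟩
  obtain ⟨i, hi, rfl⟩ := hβi
  refine ⟨?_, i, hi, A, hA, ?_⟩
  · rw [irrational_iff_ne_rational]
    push Not
    have hq0 : (q : ℝ) ≠ 0 := by
      intro h
      rw [h, mul_zero] at hq
      exact (one_div_pos.2 hβ).ne' hq
    -- From 1/i = ξq.
    have : ξ = ((1 / (i * q) : ℚ) : ℝ) := by
      push_cast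
      field_simp at hq ⊢
      linarith
    refine ⟨(1 / (i * q) : ℚ).num, (1 / (i * q) : ℚ).den, by simp, ?_⟩
    rw [this]
    exact_mod_cast (Rat.num_div_den _).symm
  · filter_upwards [hG] with r hr
    rw [hr, show ((i : ℝ) ^ 2) = ((i ^ 2 : ℕ) : ℝ) by push_cast; rfl, Real.rpow_natCast]

end Exponent

end Revolution

namespace Revolution

/-! ### From the local to the global form of the potential -/

section Radial

theorem IsMotionOn.hasDerivAt_angle {ξ : ℝ} (hξ : 0 < ξ) {V r φ : ℝ → ℝ} {J : Set ℝ} {K : ℝ}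
    (hm : IsMotionOn (Ioi 0) (coneProfile ξ) V J r φ)
    (hK : HasMomentum (coneProfile ξ) J r φ K) {t : ℝ} (ht : t ∈ J) :
    HasDerivAt φ (K / (ξ * r t) ^ 2) t := by
  have h1 : 0 < r t := (hm t ht).1
  rw [← hK t ht, coneProfile, mul_div_cancel_left₀ _ (by positivity)]
  exact (hm t ht).2.2.1.hasDerivAt

theorem IsMotionOn.hasDerivAt_radialVelocity {ξ : ℝ} (hξ : 0 < ξ) {V r φ : ℝ → ℝ} {J : Set ℝ}
    {K : ℝ} (hm : IsMotionOn (Ioi 0) (coneProfile ξ) V J r φ)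
    (hK : HasMomentum (coneProfile ξ) J r φ K) {t : ℝ} (ht : t ∈ J) :
    HasDerivAt (deriv r) (((K / ξ) ^ 2 - circularMomentumSq V (r t)) / r t ^ 3) t := by
  have h1 : 0 < r t := (hm t ht).1
  refine (hm t ht).2.2.2.1.congr_deriv ?_
  rw [(hm.hasDerivAt_angle hξ hK ht).deriv, deriv_coneProfile,
    deriv_eq_circularMomentumSq_div V h1, coneProfile]
  field_simp

/-- A positive second derivative would make the maximum a local minimum too, so f would be locally
constant. -/
theorem IsLocalMax.deriv2_nonpos {f : ℝ → ℝ} {x d : ℝ} (h : IsLocalMax f x)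
    (hc : ContinuousAt f x) (hd : HasDerivAt (deriv f) d x) : d ≤ 0 := by
  by_contra hcon
  have hmin := isLocalMin_of_deriv_deriv_pos (by rw [hd.deriv]; exact not_le.1 hcon)
    h.deriv_eq_zero hc
  have heq : f =ᶠ[𝓝 x] fun _ => f x := by
    filter_upwards [h, hmin] with y h3 h4
    exact le_antisymm h3 h4
  have := heq.deriv.deriv_eq
  rw [hd.deriv] at this
  simp at this
  linarith

theorem IsLocalMin.deriv2_nonneg {f : ℝ → ℝ} {x d : ℝ} (h : IsLocalMin f x)
    (hc : ContinuousAt f x) (hd : HasDerivAt (deriv f) d x) : 0 ≤ d := by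
  have e1 : deriv (-f) = -deriv f := by funext y; exact deriv.neg
  have := IsLocalMax.deriv2_nonpos (f := -f) h.neg hc.neg (by rw [e1]; exact hd.neg)
  linarith

end Radial

section Global

theorem conePotential_one (A B r : ℝ) : conePotential 1 A B r = -A / r + B := by
  simp [conePotential, div_eq_mul_inv]

theorem conePotential_two (A B r : ℝ) : conePotential 2 A B r = A * r ^ 2 / 2 + B := by
  have : ((2 : ℕ) : ℤ) ^ 2 - 2 = (2 : ℕ) := by norm_num
  rw [conePotential, this, zpow_natCast]
  norm_num

theorem hasDerivAt_conePotential {i : ℕ} (hi : i = 1 ∨ i = 2) (A B : ℝ) {r : ℝ} (hr : 0 < r) :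
    HasDerivAt (conePotential i A B) (A * r ^ (i ^ 2) / r ^ 3) r := by
  rcases hi with rfl | rfl
  · rw [funext (conePotential_one A B)]
    refine (((hasDerivAt_const r (-A)).div (hasDerivAt_id r) hr.ne').add_const B).congr_deriv ?_
    simp only [id]
    field_simp
    ring
  · rw [funext (conePotential_two A B)]
    refine ((((hasDerivAt_pow 2 r).const_mul A).div_const 2).add_const B).congr_deriv ?_
    field_simp
    norm_num
    ring

variable {ξ : ℝ} {V : ℝ → ℝ}

/-- If one circle is strongly stable, and all circles with a nondegenerate minimum of the
effective potential have closed nearby orbits, the potential is Newton's or Hooke's. -/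
theorem isConePotential_of_nearbyOrbitsClosed (hξ : 0 < ξ) (hV : ContDiffOn ℝ ∞ V (Ioi 0))
    (hex : ∃ r₀, 0 < r₀ ∧ 0 < circularMomentumSq V r₀ ∧ 0 < deriv (circularMomentumSq V) r₀)
    (H : ∀ r₀, 0 < r₀ → 0 < circularMomentumSq V r₀ → 0 < deriv (circularMomentumSq V) r₀ →
      ∃ K₀, K₀ ≠ 0 ∧ (K₀ / ξ) ^ 2 = circularMomentumSq V r₀ ∧
        NearbyOrbitsClosed (Ioi 0) (coneProfile ξ) V r₀ K₀) :
    ¬ Irrational ξ ∧ IsConePotential V := by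
  obtain ⟨r₀, hr₀, hG₀, hG'₀⟩ := hex
  have hGs := contDiffOn_circularMomentumSq hV
  obtain ⟨K₀, hK0, hK, hnear⟩ := H r₀ hr₀ hG₀ hG'₀
  obtain ⟨hirr, i, hi, A, hA, hev⟩ := circularMomentumSq_eq_near hξ hV hr₀ hK0 hK hG'₀ hnear
  refine ⟨hirr, i, hi, A, ?_⟩
  have hi0 : (0 : ℝ) < (i ^ 2 : ℕ) := by rcases hi with rfl | rfl <;> norm_num
  set G := circularMomentumSq V with hG
  set S : Set ℝ := {x | ∀ᶠ y in 𝓝 x, G y = A * y ^ (i ^ 2)} with hS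
  have hSopen : IsOpen S := isOpen_setOfPred_eventually_nhds
  have hpow : ∀ (j : ℕ) (C x : ℝ), 0 < x → (∀ᶠ y in 𝓝 x, G y = C * y ^ (j ^ 2)) →
      x * deriv G x = (j ^ 2 : ℕ) * G x := by
    intro j C x hx h
    have h1 : HasDerivAt (fun y : ℝ => C * y ^ (j ^ 2)) (C * ((j ^ 2 : ℕ) * x ^ (j ^ 2 - 1))) x :=
      (hasDerivAt_pow (j ^ 2) x).const_mul C
    rw [(h1.congr_of_eventuallyEq h).deriv, h.self_of_nhds]
    rcases Nat.eq_zero_or_pos (j ^ 2) with h0 | h0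
    · rw [h0]; simp
    · obtain ⟨k, hk⟩ := Nat.exists_eq_succ_of_ne_zero h0.ne'
      rw [hk, Nat.succ_sub_one, pow_succ]
      ring
  have hsub : Ioi (0 : ℝ) ⊆ S := by
    -- At a limit point x of S the relations G = A rⁱ² (exponent i squared) and rG' = i²G persist by
    -- continuity, so G and G' are positive at x. The local theorem thus applies at x, and its
    -- exponent and constant must agree with i and A.
    refine isPreconnected_Ioi.subset_of_closure_inter_subset hSopen ⟨r₀, hr₀, hev⟩ ?_
    rintro x ⟨hx, hx0⟩
    have hx0 : 0 < x := hx0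
    have hfreq : ∃ᶠ y in 𝓝 x, y ∈ S := mem_closure_iff_frequently.1 hx
    have hGc : ContinuousAt G x := hGs.continuousOn.continuousAt (Ioi_mem_nhds hx0)
    have hG'c : ContinuousAt (deriv G) x :=
      (contDiffOn_deriv_Ioi hGs).continuousOn.continuousAt (Ioi_mem_nhds hx0)
    have h1 : G x = A * x ^ (i ^ 2) := by
      have hc : ContinuousAt (fun y : ℝ => A * y ^ (i ^ 2)) x := by fun_prop
      exact tendsto_nhds_unique_of_frequently_eq hGc.tendsto hc.tendsto
        (hfreq.mono fun y hy => hy.self_of_nhds)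
    have h2 : x * deriv G x = (i ^ 2 : ℕ) * G x := by
      refine tendsto_nhds_unique_of_frequently_eq (continuousAt_id.mul hG'c).tendsto
        (continuousAt_const.mul hGc).tendsto ((hfreq.and_eventually (Ioi_mem_nhds hx0)).mono ?_)
      rintro y ⟨hy, hy0⟩
      exact hpow i A y hy0 hy
    have h3 : 0 < G x := by rw [h1]; positivity
    have h4 : 0 < deriv G x := by
      have : 0 < x * deriv G x := by rw [h2]; positivity
      exact pos_of_mul_pos_right this hx0.le
    obtain ⟨K₁, hK10, hK1, hnear₁⟩ := H x hx0 h3 h4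
    obtain ⟨-, j, hj, C, hC, hev'⟩ := circularMomentumSq_eq_near hξ hV hx0 hK10 hK1 h4 hnear₁
    have h5 := hpow j C x hx0 hev'
    rw [h2] at h5
    have h6 : i ^ 2 = j ^ 2 := by exact_mod_cast mul_right_cancel₀ h3.ne' h5
    have h7 : C = A := by
      have := hev'.self_of_nhds
      rw [← hG, h1, ← h6] at this
      exact (mul_right_cancel₀ (by positivity) this).symm
    rw [← h6, h7] at hev'
    exact hev'
  have hd : ∀ r ∈ Ioi (0 : ℝ), HasDerivAt (fun r => V r - conePotential i A 0 r) 0 r := by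
    intro r hr
    have hr : 0 < r := hr
    refine ((hasDerivAt_of_contDiffOn_Ioi hV hr).sub
      (hasDerivAt_conePotential hi A 0 hr)).congr_deriv ?_
    have h1 : G r = A * r ^ (i ^ 2) := (hsub hr).self_of_nhds
    rw [deriv_eq_circularMomentumSq_div V hr, ← hG, h1, sub_self]
  refine ⟨V 1 - conePotential i A 0 1, hA, fun r hr => ?_⟩
  have := isOpen_Ioi.is_const_of_deriv_eq_zero isPreconnected_Ioi
    (fun x hx => (hd x hx).differentiableAt.differentiableWithinAt)
    (fun x hx => (hd x hx).deriv) (mem_Ioi.2 hr)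
    (mem_Ioi.2 zero_lt_one)
  simp only [conePotential, add_zero] at this ⊢
  linarith

end Global

/-! ### A strongly stable circle from one closed noncircular orbit. -/

section Semilocal

variable {ξ : ℝ} {V : ℝ → ℝ}

/-- Take a level m strictly between max(G(x), 0) and G(y), and the last point c of [x, y] with G ≤
m. On (c, y) one has G > m > 0, and the mean value theorem on [c, y] gives a point with G' > 0. -/
theorem exists_deriv_pos_of_lt (hV : ContDiffOn ℝ ∞ V (Ioi 0)) {x y : ℝ} (hx : 0 < x)
    (hxy : x < y) (hlt : circularMomentumSq V x < circularMomentumSq V y)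
    (hy : 0 < circularMomentumSq V y) :
    ∃ z, 0 < z ∧ 0 < circularMomentumSq V z ∧ 0 < deriv (circularMomentumSq V) z := by
  set G := circularMomentumSq V with hG
  obtain ⟨m, hm1, hm2⟩ := exists_between (max_lt hlt hy)
  have hc : ContinuousOn G (Icc x y) := (contDiffOn_circularMomentumSq hV).continuousOn.mono
    fun z hz => hx.trans_le hz.1
  have hcomp : IsCompact {z ∈ Icc x y | G z ≤ m} :=
    isCompact_Icc.of_isClosed_subset (hc.preimage_isClosed_of_isClosed isClosed_Icc isClosed_Iic)
      inter_subset_left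
  obtain ⟨c, hcm, hcg⟩ := hcomp.exists_isGreatest
    ⟨x, ⟨le_rfl, hxy.le⟩, (le_max_left _ _).trans hm1.le⟩
  have hcy : c < y := lt_of_le_of_ne hcm.1.2 fun h => by
    have := hcm.2
    rw [h] at this
    linarith
  obtain ⟨z, hz, hzd⟩ := exists_deriv_eq_slope G hcy (hc.mono (Icc_subset_Icc_left hcm.1.1))
    fun w hw => (hasDerivAt_circularMomentumSq hV
      (hx.trans_le (hcm.1.1.trans hw.1.le))).differentiableAt.differentiableWithinAt
  refine ⟨z, hx.trans_le (hcm.1.1.trans hz.1.le), ?_, ?_⟩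
  · have : m < G z := by
      by_contra hcon
      exact absurd (hcg ⟨⟨hcm.1.1.trans hz.1.le, hz.2.le⟩, not_lt.1 hcon⟩) (not_le.2 hz.1)
    exact ((le_max_right _ _).trans_lt hm1).trans this
  · rw [hzd]
    have := hcm.2
    exact div_pos (by linarith) (by linarith)

/-- Periodicity makes r attain its extremes. The sign of the radial acceleration there gives G ≤
(K/ξ)² at the minimum and G ≥ (K/ξ)² at the maximum. If either inequality is strict, G increases
between the two radii. If both are equalities, either G increases between some radii of the orbit,
or G = (K/ξ)² all along it; then the radial acceleration vanishes and r is constant. -/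
theorem exists_stable_of_closed_noncircular (hξ : 0 < ξ) (hV : ContDiffOn ℝ ∞ V (Ioi 0))
    {r φ : ℝ → ℝ} {K : ℝ} (h : IsNonsingularBounded (Ioi 0) (coneProfile ξ) V r φ K)
    (hnc : ¬ OrbitIsCircular r φ) (hcl : OrbitIsClosed r φ) :
    ∃ z, 0 < z ∧ 0 < circularMomentumSq V z ∧ 0 < deriv (circularMomentumSq V) z := by
  obtain ⟨⟨hm, -⟩, hmom, hK0⟩ := h
  obtain ⟨T, hT, hper⟩ := hcl
  set G := circularMomentumSq V with hG
  have hrpos : ∀ t, 0 < r t := fun t => (hm t (mem_univ _)).1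
  have hrdiff : ∀ t, DifferentiableAt ℝ r t := fun t => (hm t (mem_univ _)).2.1
  have hrc : Continuous r := continuous_iff_continuousAt.2 fun t => (hrdiff t).continuousAt
  have hrd2 := fun t => hm.hasDerivAt_radialVelocity hξ hmom (mem_univ t)
  have hrper : Function.Periodic r T := fun t => (hper t).1
  have hL : 0 < (K / ξ) ^ 2 := by have := div_ne_zero hK0 hξ.ne'; positivity
  obtain ⟨t₁, -, h₁⟩ := (isCompact_Icc (a := (0 : ℝ)) (b := T)).exists_isMaxOn
    (nonempty_Icc.2 hT.le) hrc.continuousOn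
  obtain ⟨t₀, -, h₀⟩ := (isCompact_Icc (a := (0 : ℝ)) (b := T)).exists_isMinOn
    (nonempty_Icc.2 hT.le) hrc.continuousOn
  have hmax : ∀ t, r t ≤ r t₁ := fun t => by
    obtain ⟨s, hs, hst⟩ := hrper.exists_mem_Ico₀ hT t
    rw [hst]; exact h₁ (Ico_subset_Icc_self hs)
  have hmin : ∀ t, r t₀ ≤ r t := fun t => by
    obtain ⟨s, hs, hst⟩ := hrper.exists_mem_Ico₀ hT t
    rw [hst]; exact h₀ (Ico_subset_Icc_self hs)
  have hmax' : IsLocalMax r t₁ := Eventually.of_forall hmax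
  have hmin' : IsLocalMin r t₀ := Eventually.of_forall hmin
  have e₁ : (K / ξ) ^ 2 ≤ G (r t₁) := by
    have := IsLocalMax.deriv2_nonpos hmax' hrc.continuousAt (hrd2 t₁)
    rw [div_nonpos_iff] at this
    rcases this with h | h
    · exact absurd h.2 (not_le.2 (pow_pos (hrpos _) 3))
    · linarith [h.1]
  have e₀ : G (r t₀) ≤ (K / ξ) ^ 2 := by
    have := IsLocalMin.deriv2_nonneg hmin' hrc.continuousAt (hrd2 t₀)
    rw [le_div_iff₀ (pow_pos (hrpos _) 3)] at this
    linarith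
  have hlt : r t₀ < r t₁ := by
    refine lt_of_le_of_ne (hmin t₁) fun heq => hnc ⟨r t₀, ?_⟩
    exact orbitIsCircle_of_eq_const rfl hm hmom hK0 fun t =>
      le_antisymm ((hmax t).trans heq.symm.le) (hmin t)
  rcases lt_or_eq_of_le (e₀.trans e₁) with h | h
  · exact exists_deriv_pos_of_lt hV (hrpos t₀) hlt h (hL.trans_le e₁)
  by_contra hcon
  have hGr : ∀ t, G (r t) = (K / ξ) ^ 2 := by
    intro t
    rcases lt_trichotomy (G (r t)) ((K / ξ) ^ 2) with h2 | h2 | h2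
    · have h3 : G (r t) < G (r t₁) := by linarith
      exact absurd (exists_deriv_pos_of_lt hV (hrpos t)
        (lt_of_le_of_ne (hmax t) fun h4 => by rw [h4] at h3; exact lt_irrefl _ h3) h3
        (by linarith)) hcon
    · exact h2
    · have h3 : G (r t₀) < G (r t) := by linarith
      exact absurd (exists_deriv_pos_of_lt hV (hrpos t₀)
        (lt_of_le_of_ne (hmin t) fun h4 => by rw [h4] at h3; exact lt_irrefl _ h3) h3
        (by linarith)) hcon
  have hd0 : ∀ t, deriv r t = 0 := by
    intro t
    have h2 : ∀ s, HasDerivAt (deriv r) 0 s := fun s => by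
      refine (hrd2 s).congr_deriv ?_
      rw [← hG, hGr, sub_self, zero_div]
    rw [is_const_of_deriv_eq_zero (fun s => (h2 s).differentiableAt) (fun s => (h2 s).deriv) t t₁]
    exact hmax'.deriv_eq_zero
  exact hlt.ne (is_const_of_deriv_eq_zero hrdiff hd0 t₀ t₁)

end Semilocal

end Revolution

namespace Revolution

/-! ### Orbital stability -/

section Construct

variable {ξ : ℝ} {V : ℝ → ℝ}

/-- A solution of the radial equation and its angle form a motion. -/
theorem isMotionOn_of_radial (hξ : 0 < ξ) {r φ : ℝ → ℝ} {J : Set ℝ} {K : ℝ} (hJ : IsOpen J)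
    (hr : ∀ t ∈ J, 0 < r t) (hrd : ∀ t ∈ J, DifferentiableAt ℝ r t)
    (hr2 : ∀ t ∈ J, HasDerivAt (deriv r)
      (((K / ξ) ^ 2 - circularMomentumSq V (r t)) / r t ^ 3) t)
    (hφ : ∀ t ∈ J, HasDerivAt φ (K / (ξ * r t) ^ 2) t) :
    IsMotionOn (Ioi 0) (coneProfile ξ) V J r φ ∧ HasMomentum (coneProfile ξ) J r φ K := by
  have hmom : HasMomentum (coneProfile ξ) J r φ K := by
    intro t ht
    have := hr t ht
    rw [(hφ t ht).deriv, coneProfile]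
    field_simp
  refine ⟨fun t ht => ⟨hr t ht, hrd t ht, (hφ t ht).differentiableAt, ?_, ?_⟩, hmom⟩
  · refine (hr2 t ht).congr_deriv ?_
    have := hr t ht
    rw [(hφ t ht).deriv, deriv_coneProfile, deriv_eq_circularMomentumSq_div V this, coneProfile]
    field_simp
  · refine (hasDerivAt_const t K).congr_of_eventuallyEq ?_
    filter_upwards [hJ.mem_nhds ht] with s hs using hmom s hs

end Construct

section Instability

variable {ξ : ℝ} {V : ℝ → ℝ}

/-- The motion that leaves a maximum `r = 1` of the effective potential with velocity `v > 0`. -/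
theorem exists_escaping_motion (hξ : 0 < ξ) (hV : ContDiffOn ℝ ∞ V (Ioi 0)) {K : ℝ}
    (hW : ∀ x, 0 < x → effectivePotential (coneProfile ξ) V K x ≤
      effectivePotential (coneProfile ξ) V K 1) {v : ℝ} (hv : 0 < v) :
    ∃ (a b : ℝ) (ρ ψ : ℝ → ℝ), a < 0 ∧ 0 < b ∧ IsMotionOn (Ioi 0) (coneProfile ξ) V (Ioo a b) ρ ψ ∧
      HasMomentum (coneProfile ξ) (Ioo a b) ρ ψ K ∧ ρ 0 = 1 ∧ ψ 0 = 0 ∧ deriv ρ 0 = v ∧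
      ∃ t ∈ Ico 0 b, ρ t = 3 / 2 := by
  set W := effectivePotential (coneProfile ξ) V K with hWdef
  -- The radial speed prescribed by energy conservation; it is at least v because W ≤ W(1).
  set S : ℝ → ℝ := fun x => √(v ^ 2 + 2 * (W 1 - W x)) with hS
  have hWd : ∀ x, 0 < x → HasDerivAt W ((circularMomentumSq V x - (K / ξ) ^ 2) / x ^ 3) x :=
    fun x hx => hasDerivAt_effectivePotential hξ hV K hx
  have harg : ∀ x, 0 < x → 0 < v ^ 2 + 2 * (W 1 - W x) := fun x hx => by
    have := hW x hx; have := pow_pos hv 2; linarith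
  have hSv : ∀ x, 0 < x → v ≤ S x := fun x hx => Real.le_sqrt_of_sq_le (by linarith [hW x hx])
  have hSd : ∀ x, 0 < x →
      HasDerivAt S (-((circularMomentumSq V x - (K / ξ) ^ 2) / x ^ 3) / S x) x := by
    intro x hx
    refine ((((hWd x hx).const_sub (W 1)).const_mul 2).const_add (v ^ 2)).sqrt
      (harg x hx).ne' |>.congr_deriv ?_
    have : S x ≠ 0 := (hv.trans_le (hSv x hx)).ne'
    change _ / (2 * S x) = _
    field_simp
  have h12 : (1 / 2 : ℝ) ≤ 2 := by norm_num
  -- Clamping the radius to [1/2, 2] makes the speed positive, continuous and bounded on all of ℝ,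
  -- so the time change is global; on (a, b) the clamp is inactive.
  set p : ℝ → ℝ := fun x => projIcc (1 / 2) 2 h12 (1 + x) with hp
  have hpc : Continuous p := continuous_subtype_val.comp (continuous_projIcc.comp (by fun_prop))
  have hpm : ∀ x, p x ∈ Icc (1 / 2 : ℝ) 2 := fun x => (projIcc _ _ _ _).2
  have hppos : ∀ x, 0 < p x := fun x => lt_of_lt_of_le (by norm_num) (hpm x).1
  have hpeq : ∀ x, 1 + x ∈ Icc (1 / 2 : ℝ) 2 → p x = 1 + x := fun x hx => by
    simp only [hp]; rw [projIcc_of_mem h12 hx]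
  have hSpc : Continuous fun x => S (p x) := by
    refine continuous_iff_continuousAt.2 fun x => ?_
    exact ContinuousAt.comp (f := p) (hSd _ (hppos x)).continuousAt hpc.continuousAt
  obtain ⟨M, hM⟩ : ∃ M, ∀ x, S (p x) ≤ M := by
    have hc : ContinuousOn S (Icc (1 / 2 : ℝ) 2) := fun x hx =>
      (hSd x (lt_of_lt_of_le (by norm_num) hx.1)).continuousAt.continuousWithinAt
    obtain ⟨M, hM⟩ := (isCompact_Icc.image_of_continuousOn hc).bddAbove
    exact ⟨M, fun x => hM (mem_image_of_mem S (hpm x))⟩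
  have hSp : ∀ x, 0 < S (p x) := fun x => hv.trans_le (hSv _ (hppos x))
  have hMpos : 0 < M := (hSp 0).trans_le (hM 0)
  obtain ⟨α, hα0, hα⟩ := exists_hasDerivAt_inv_comp (b := fun x => (S (p x))⁻¹)
    (hSpc.inv₀ fun x => (hSp x).ne') (inv_pos.2 hMpos) fun x => inv_anti₀ (hSp x) (hM x)
  simp only [inv_inv] at hα
  have hαc : Continuous α := continuous_iff_continuousAt.2 fun t => (hα t).continuousAt
  have hαmono : StrictMono α := strictMono_of_deriv_pos fun t => by
    rw [(hα t).deriv]; exact hSp _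
  have hmono2 : Monotone fun t => α t - v * t := by
    refine monotone_of_deriv_nonneg (fun t => ?_) fun t => ?_
    · exact ((hα t).sub ((hasDerivAt_id t).const_mul v)).differentiableAt
    · have h2 : deriv (fun t => α t - v * t) t = S (p (α t)) - v * 1 :=
        ((hα t).sub ((hasDerivAt_id t).const_mul v)).deriv
      rw [h2]
      linarith [hSv _ (hppos (α t))]
  have hreach : ∀ y, 0 < y → ∃ t, 0 < t ∧ α t = y := by
    intro y hy
    have hT : 0 < y / v := div_pos hy hv
    have h1 : y ≤ α (y / v) := by
      have := hmono2 hT.le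
      simp only [hα0, mul_div_cancel₀ _ hv.ne'] at this
      linarith
    obtain ⟨t, ht, hty⟩ := intermediate_value_Icc hT.le hαc.continuousOn
      (show y ∈ Icc (α 0) (α (y / v)) from ⟨by rw [hα0]; exact hy.le, h1⟩)
    refine ⟨t, lt_of_le_of_ne ht.1 fun h => ?_, hty⟩
    rw [← h, hα0] at hty
    exact hy.ne hty
  -- The motion ends at radius 7/4, still inside the clamped range, after passing 3/2.
  obtain ⟨b, hb, hbα⟩ := hreach (3 / 4) (by norm_num)
  obtain ⟨s, hs, hsα⟩ := hreach (1 / 2) (by norm_num)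
  obtain ⟨a, ha, haα⟩ : ∃ a, a < 0 ∧ -(1 / 2) ≤ α a := by
    have h1 : ∀ᶠ t in 𝓝[<] (0 : ℝ), -(1 / 2) < α t :=
      nhdsWithin_le_nhds (hαc.continuousAt.eventually (lt_mem_nhds (by rw [hα0]; norm_num)))
    obtain ⟨a, h1, h2⟩ := (h1.and self_mem_nhdsWithin).exists
    exact ⟨a, h2, h1.le⟩
  have hIoo : ∀ t ∈ Ioo a b, p (α t) = 1 + α t := fun t ht => hpeq _ (by
    have h1 := hαmono ht.1
    have h2 := hαmono ht.2
    exact ⟨by linarith, by linarith⟩)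
  set ρ : ℝ → ℝ := fun t => 1 + α t with hρ
  have hρd : ∀ t ∈ Ioo a b, HasDerivAt ρ (S (ρ t)) t := fun t ht => by
    have := (hα t).const_add 1
    rwa [hIoo t ht] at this
  have hρpos : ∀ t ∈ Ioo a b, 0 < ρ t := fun t ht => by
    have := hppos (α t)
    rwa [hIoo t ht] at this
  have hψc : Continuous fun t => K / (ξ * p (α t)) ^ 2 :=
    continuous_const.div (by fun_prop) fun t => by have := hppos (α t); positivity
  set ψ : ℝ → ℝ := fun t => ∫ y in (0 : ℝ)..t, K / (ξ * p (α y)) ^ 2 with hψ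
  have hψd : ∀ t ∈ Ioo a b, HasDerivAt ψ (K / (ξ * ρ t) ^ 2) t := fun t ht => by
    have := intervalIntegral.integral_hasDerivAt_right (hψc.intervalIntegrable 0 t)
      (hψc.stronglyMeasurableAtFilter _ _) hψc.continuousAt
    rwa [hIoo t ht] at this
  have h0 : (0 : ℝ) ∈ Ioo a b := ⟨ha, hb⟩
  obtain ⟨h1, h2⟩ := isMotionOn_of_radial (V := V) (K := K) hξ isOpen_Ioo hρpos
    (fun t ht => (hρd t ht).differentiableAt) (fun t ht => by
      have h3 := (hSd _ (hρpos t ht)).comp t (hρd t ht)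
      refine (h3.congr_of_eventuallyEq ?_).congr_deriv ?_
      · filter_upwards [isOpen_Ioo.mem_nhds ht] with s hs
        exact (hρd s hs).deriv
      · have := (hv.trans_le (hSv _ (hρpos t ht))).ne'
        rw [div_mul_cancel₀ _ this]
        ring) hψd
  refine ⟨a, b, ρ, ψ, ha, hb, h1, h2, by simp [hρ, hα0], by simp [hψ], ?_, s, ⟨hs.le, ?_⟩, ?_⟩
  · rw [(hρd 0 h0).deriv]
    simp [hρ, hα0, hS, Real.sqrt_sq hv.le]
  · apply hαmono.lt_iff_lt.1
    rw [hsα, hbα]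
    norm_num
  · simp only [hρ, hsα]
    norm_num

/-- Every circle being an orbit, G > 0 everywhere. If G' were never positive, G would be
nonincreasing, and the effective potential with the momentum of the circle r = 1 would be maximal
there. Motions leaving that circle at arbitrarily small radial speed reach 3/2, contradicting
stability. -/
theorem exists_stable_of_orbitallyStable (hξ : 0 < ξ) (hV : ContDiffOn ℝ ∞ V (Ioi 0))
    (h : ∀ r₀ ∈ Ioi (0 : ℝ), ∃ K₀, IsOrbitallyStable (Ioi 0) (coneProfile ξ) V r₀ K₀) :
    ∃ z, 0 < z ∧ 0 < circularMomentumSq V z ∧ 0 < deriv (circularMomentumSq V) z := by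
  set G := circularMomentumSq V with hG
  have hGpos : ∀ x, 0 < x → 0 < G x := by
    intro x hx
    obtain ⟨K, r, φ, hc, -⟩ := h x hx
    obtain ⟨-, h1, h2⟩ := hc.pos_and_momentum hξ
    rw [hG, ← h2]
    have := div_ne_zero h1 hξ.ne'
    positivity
  by_contra hcon
  push Not at hcon
  have hGs := contDiffOn_circularMomentumSq hV
  have hanti : AntitoneOn G (Ioi 0) := by
    refine antitoneOn_of_deriv_nonpos (convex_Ioi 0) hGs.continuousOn
      (hGs.differentiableOn (by simp) |>.mono interior_subset) fun x hx => ?_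
    rw [interior_Ioi] at hx
    exact hcon x hx (hGpos x hx)
  obtain ⟨K, r, φ, hc, hst⟩ := h 1 (mem_Ioi.2 zero_lt_one)
  obtain ⟨-, hK0, hK⟩ := hc.pos_and_momentum hξ
  rw [← hG] at hK
  set W := effectivePotential (coneProfile ξ) V K with hWdef
  have hWd : ∀ x, 0 < x → HasDerivAt W ((G x - (K / ξ) ^ 2) / x ^ 3) x :=
    fun x hx => hasDerivAt_effectivePotential hξ hV K hx
  have hWc : ContinuousOn W (Ioi 0) := fun x hx => (hWd x hx).continuousAt.continuousWithinAt
  have hW : ∀ x, 0 < x → W x ≤ W 1 := by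
    intro x hx
    rcases le_total x 1 with h1 | h1
    · have hsub : Icc x 1 ⊆ Ioi 0 := fun y hy => hx.trans_le hy.1
      refine monotoneOn_of_deriv_nonneg (convex_Icc x 1) (hWc.mono hsub)
        (fun y hy => (hWd y (hsub (interior_subset hy))).differentiableAt.differentiableWithinAt)
        (fun y hy => ?_) (left_mem_Icc.2 h1) (right_mem_Icc.2 h1) h1
      have hy' := interior_subset hy
      have hy0 : 0 < y := hsub hy'
      rw [(hWd y hy0).deriv, hK]
      have := hanti hy0 (mem_Ioi.2 zero_lt_one) hy'.2
      exact div_nonneg (by linarith) (by positivity)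
    · have hsub : Icc 1 x ⊆ Ioi 0 := fun y hy => zero_lt_one.trans_le hy.1
      refine antitoneOn_of_deriv_nonpos (convex_Icc 1 x) (hWc.mono hsub)
        (fun y hy => (hWd y (hsub (interior_subset hy))).differentiableAt.differentiableWithinAt)
        (fun y hy => ?_) (left_mem_Icc.2 h1) (right_mem_Icc.2 h1) h1
      have hy' := interior_subset hy
      have hy0 : 0 < y := hsub hy'
      rw [(hWd y hy0).deriv, hK]
      have := hanti (mem_Ioi.2 zero_lt_one) hy0 hy'.1
      exact div_nonpos_of_nonpos_of_nonneg (by linarith) (by positivity)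
  have hr1 : ∀ t, r t = 1 := hc.2.2.eq_const
  have hdr : ∀ t, deriv r t = 0 := fun t => by
    rw [show r = fun _ => 1 from funext hr1]; simp
  have hdφ : ∀ t, deriv φ t = K / ξ ^ 2 := fun t => by
    rw [(hc.1.hasDerivAt_angle hξ hc.2.1 (mem_univ t)).deriv, hr1, mul_one]
  obtain ⟨t₀, ht₀⟩ : ∃ t₀, (φ t₀ : Real.Angle) = 0 := by
    have : ((1 : ℝ), (0 : Real.Angle)) ∈ orbit r φ := by rw [hc.2.2]; simp
    obtain ⟨t, ht⟩ := this
    exact ⟨t, (Prod.mk.inj ht).2⟩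
  -- Any bound strictly between 1 and 3/2 serves.
  set U : Set ((ℝ × Real.Angle) × (ℝ × ℝ)) := {x | x.1.1 < 5 / 4} with hU
  have hUo : IsOpen U := isOpen_lt (by fun_prop) continuous_const
  have hUmem : U ∈ 𝓝ˢ (phaseOrbit r φ) := hUo.mem_nhdsSet.2 (by
    rintro _ ⟨t, rfl⟩
    simp only [hU, phase, mem_ofPred_eq, hr1]
    norm_num)
  obtain ⟨N, hN, hstab⟩ := hst U hUmem
  have hpt : phase r φ t₀ = ((1, 0), (0, K / ξ ^ 2)) := by
    simp only [phase, hr1, hdr, hdφ, ht₀]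
  have hN0 : N ∈ 𝓝 (((1 : ℝ), (0 : Real.Angle)), ((0 : ℝ), K / ξ ^ 2)) := by
    rw [← hpt]
    exact mem_nhdsSet_iff_forall.1 hN _ ⟨t₀, rfl⟩
  have hcv : ContinuousAt (fun v : ℝ => (((1 : ℝ), (0 : Real.Angle)), (v, K / ξ ^ 2))) 0 := by
    fun_prop
  have hev : ∀ᶠ v in 𝓝[>] (0 : ℝ), (((1 : ℝ), (0 : Real.Angle)), (v, K / ξ ^ 2)) ∈ N :=
    nhdsWithin_le_nhds (hcv hN0)
  obtain ⟨v, hvN, hv⟩ := (hev.and self_mem_nhdsWithin).exists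
  obtain ⟨a, b, ρ, ψ, ha, hb, hm, hmom, h1, h2, h3, t, ht, h4⟩ :=
    exists_escaping_motion hξ hV hW hv
  have hphase : phase ρ ψ 0 = ((1, 0), (v, K / ξ ^ 2)) := by
    simp only [phase, h1, h2, h3, (hm.hasDerivAt_angle hξ hmom ⟨ha, hb⟩).deriv, mul_one,
      Real.Angle.coe_zero]
  have := hstab a b ρ ψ ha hb hm hmom (by rw [hphase]; exact hvN) t ht
  simp only [hU, phase, mem_ofPred_eq, h4] at this
  norm_num at this

end Instability

end Revolution

namespace Revolution

/-! ### Orbits in the two potentials -/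

section Stability

variable {ξ : ℝ} {V : ℝ → ℝ}

theorem effectivePotential_lt (hξ : 0 < ξ) (hV : ContDiffOn ℝ ∞ V (Ioi 0)) {r₀ K : ℝ}
    (hr₀ : 0 < r₀) (hK : (K / ξ) ^ 2 = circularMomentumSq V r₀)
    (hmono : StrictMonoOn (circularMomentumSq V) (Ioi 0)) {x : ℝ} (hx : 0 < x) (hne : x ≠ r₀) :
    effectivePotential (coneProfile ξ) V K r₀ < effectivePotential (coneProfile ξ) V K x := by
  have hWd := fun y (hy : 0 < y) => hasDerivAt_effectivePotential hξ hV K hy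
  set W := effectivePotential (coneProfile ξ) V K
  have hWc : ContinuousOn W (Ioi 0) := fun y hy => (hWd y hy).continuousAt.continuousWithinAt
  rcases hne.lt_or_gt with h | h
  · have hsub : Icc x r₀ ⊆ Ioi 0 := fun y hy => hx.trans_le hy.1
    refine strictAntiOn_of_deriv_neg (convex_Icc x r₀) (hWc.mono hsub) (fun y hy => ?_)
      (left_mem_Icc.2 h.le) (right_mem_Icc.2 h.le) h
    rw [interior_Icc] at hy
    have hy0 : 0 < y := hx.trans hy.1
    rw [(hWd y hy0).deriv, hK]
    have := hmono hy0 hr₀ hy.2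
    exact div_neg_of_neg_of_pos (by linarith) (by positivity)
  · have hsub : Icc r₀ x ⊆ Ioi 0 := fun y hy => hr₀.trans_le hy.1
    refine strictMonoOn_of_deriv_pos (convex_Icc r₀ x) (hWc.mono hsub) (fun y hy => ?_)
      (left_mem_Icc.2 h.le) (right_mem_Icc.2 h.le) h
    rw [interior_Icc] at hy
    have hy0 : 0 < y := hr₀.trans hy.1
    rw [(hWd y hy0).deriv, hK]
    have := hmono hr₀ hy0 hy.1
    exact div_pos (by linarith) (by positivity)

/-- Conservation of energy. -/
theorem IsMotionOn.energy_eq (hξ : 0 < ξ) (hV : ContDiffOn ℝ ∞ V (Ioi 0)) {r φ : ℝ → ℝ}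
    {J : Set ℝ} {K : ℝ} (hJ : IsOpen J) (hJc : IsPreconnected J)
    (hm : IsMotionOn (Ioi 0) (coneProfile ξ) V J r φ)
    (hK : HasMomentum (coneProfile ξ) J r φ K) {s t : ℝ} (hs : s ∈ J) (ht : t ∈ J) :
    deriv r s ^ 2 / 2 + effectivePotential (coneProfile ξ) V K (r s) =
      deriv r t ^ 2 / 2 + effectivePotential (coneProfile ξ) V K (r t) := by
  have hd : ∀ t ∈ J, HasDerivAt
      (fun t => deriv r t ^ 2 / 2 + effectivePotential (coneProfile ξ) V K (r t)) 0 t := by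
    intro t ht
    have h0 : 0 < r t := (hm t ht).1
    refine ((((hm.hasDerivAt_radialVelocity hξ hK ht).pow 2).div_const 2).add
      ((hasDerivAt_effectivePotential hξ hV K h0).comp t
        (hm t ht).2.1.hasDerivAt)).congr_deriv ?_
    field_simp
    ring
  exact hJ.is_const_of_deriv_eq_zero hJc
    (fun x hx => (hd x hx).differentiableAt.differentiableWithinAt)
    (fun x hx => (hd x hx).deriv) hs ht

/-- Energy is a Lyapunov function: the effective potential has its strict global minimum at r₀,
which confines the radius and the radial velocity. The angular velocity is K/(ξr)², a continuous
function of the radius. -/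
theorem isOrbitallyStable_of_strictMonoOn (hξ : 0 < ξ) (hV : ContDiffOn ℝ ∞ V (Ioi 0))
    {r₀ K : ℝ} (hr₀ : 0 < r₀) (hK0 : K ≠ 0) (hK : (K / ξ) ^ 2 = circularMomentumSq V r₀)
    (hmono : StrictMonoOn (circularMomentumSq V) (Ioi 0)) :
    IsOrbitallyStable (Ioi 0) (coneProfile ξ) V r₀ K := by
  obtain ⟨r, φ, hc⟩ := exists_isCircularTrajectory hξ hr₀ hK0 hK
  refine ⟨r, φ, hc, fun U hU => ?_⟩
  set W := effectivePotential (coneProfile ξ) V K with hWdef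
  have hWlt := fun x hx hne => effectivePotential_lt hξ hV hr₀ hK hmono (x := x) hx hne
  have hWle : ∀ x, 0 < x → W r₀ ≤ W x := fun x hx => by
    rcases eq_or_ne x r₀ with rfl | hne
    · exact le_rfl
    · exact (hWlt x hx hne).le
  have hr : ∀ t, r t = r₀ := hc.2.2.eq_const
  have hdr : ∀ t, deriv r t = 0 := fun t => by
    rw [show r = fun _ => r₀ from funext hr]; simp
  have hdφ : ∀ t, deriv φ t = K / (ξ * r₀) ^ 2 := fun t => by
    rw [(hc.1.hasDerivAt_angle hξ hc.2.1 (mem_univ t)).deriv, hr]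
  have hUall : ∀ θ : Real.Angle, ((r₀, θ), (0, K / (ξ * r₀) ^ 2)) ∈ interior U := by
    intro θ
    have : (r₀, θ) ∈ orbit r φ := by rw [hc.2.2]; simp
    obtain ⟨t, ht⟩ := this
    have h1 : phase r φ t = ((r₀, θ), (0, K / (ξ * r₀) ^ 2)) := by
      simp only [phase, hdr, hdφ]
      rw [show (r t, (φ t : Real.Angle)) = (r₀, θ) from ht]
    rw [← h1]
    exact subset_interior_iff_mem_nhdsSet.2 hU ⟨t, rfl⟩
  -- The circle of angles is compact, so the tube lemma gives one δ valid for all angles.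
  obtain ⟨δ, hδ, hUδ⟩ : ∃ δ > 0, ∀ (x y : ℝ) (θ : Real.Angle), |x - r₀| < δ → |y| < δ →
      ((x, θ), (y, K / (ξ * x) ^ 2)) ∈ U := by
    have hcont : Continuous fun z : Real.Angle × (ℝ × ℝ × ℝ) =>
        ((z.2.1, z.1), (z.2.2.1, z.2.2.2)) := by fun_prop
    have : Fact (0 < 2 * Real.pi) := ⟨Real.two_pi_pos⟩
    have : CompactSpace Real.Angle := inferInstanceAs (CompactSpace (AddCircle (2 * Real.pi)))
    obtain ⟨A, B, -, hB, hA', hB', hAB⟩ := generalized_tube_lemma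
      (isCompact_univ (X := Real.Angle))
      (isCompact_singleton (x := (r₀, (0 : ℝ), K / (ξ * r₀) ^ 2)))
      ((isOpen_interior (s := U)).preimage hcont) (by
        rintro ⟨θ, z⟩ ⟨-, hz⟩
        have hz' : z = (r₀, 0, K / (ξ * r₀) ^ 2) := hz
        subst hz'
        exact hUall θ)
    have hcc : ContinuousAt (fun z : ℝ × ℝ => (z.1, z.2, K / (ξ * z.1) ^ 2)) (r₀, 0) := by
      refine continuousAt_fst.prodMk (continuousAt_snd.prodMk ?_)
      exact continuousAt_const.div (by fun_prop) (by positivity)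
    have hev := hcc (hB.mem_nhds (hB' rfl))
    obtain ⟨δ, hδ, hball⟩ := Metric.mem_nhds_iff.1 hev
    refine ⟨δ, hδ, fun x y θ hx hy => interior_subset ?_⟩
    have h1 : (x, y) ∈ Metric.ball (r₀, (0 : ℝ)) δ := by
      rw [Metric.mem_ball, Prod.dist_eq, Real.dist_eq, Real.dist_eq, sub_zero]
      exact max_lt hx hy
    exact hAB (mk_mem_prod (hA' (mem_univ θ)) (hball h1))
  set d := min δ r₀ / 2 with hd
  have hmin : 0 < min δ r₀ := lt_min hδ hr₀
  have hd0 : 0 < d := by positivity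
  have hdδ : d < δ := by linarith [min_le_left δ r₀]
  have hdr₀ : d < r₀ := by linarith [min_le_right δ r₀]
  -- The first bound is the energy barrier at r₀ ± d; the second keeps the radial velocity below δ.
  set η := min (min (W (r₀ - d)) (W (r₀ + d)) - W r₀) (δ ^ 2 / 2) with hη
  have hη0 : 0 < η := by
    refine lt_min ?_ (by positivity)
    have h1 := hWlt (r₀ - d) (by linarith) (by linarith)
    have h2 := hWlt (r₀ + d) (by linarith) (by linarith)
    exact sub_pos.2 (lt_min h1 h2)
  refine ⟨{x | |x.1.1 - r₀| < d ∧ x.2.1 ^ 2 / 2 + W x.1.1 < W r₀ + η},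
    mem_nhdsSet_iff_forall.2 ?_, ?_⟩
  · rintro _ ⟨t, rfl⟩
    have h1 : ContinuousAt W (phase r φ t).1.1 := by
      simp only [phase, hr]
      exact (hasDerivAt_effectivePotential hξ hV K hr₀).continuousAt
    have h2 : ContinuousAt (fun x : (ℝ × Real.Angle) × (ℝ × ℝ) => x.2.1 ^ 2 / 2 + W x.1.1)
        (phase r φ t) := by
      refine ContinuousAt.add (by fun_prop) ?_
      exact ContinuousAt.comp (f := fun x : (ℝ × Real.Angle) × (ℝ × ℝ) => x.1.1) h1 (by fun_prop)
    have h3 : ContinuousAt (fun x : (ℝ × Real.Angle) × (ℝ × ℝ) => |x.1.1 - r₀|)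
        (phase r φ t) := by fun_prop
    refine Filter.Eventually.and (h3.eventually (gt_mem_nhds ?_)) (h2.eventually (gt_mem_nhds ?_))
    · simpa [phase, hr] using hd0
    · simpa [phase, hr, hdr] using hη0
  · intro a b ρ ψ ha hb hm hmom hstart t ht
    have h0 : (0 : ℝ) ∈ Ioo a b := ⟨ha, hb⟩
    have hsub : Icc 0 t ⊆ Ioo a b := fun s hs => ⟨ha.trans_le hs.1, hs.2.trans_lt ht.2⟩
    have htm : t ∈ Ioo a b := hsub ⟨ht.1, le_rfl⟩
    have hE : ∀ s ∈ Ioo a b, deriv ρ s ^ 2 / 2 + W (ρ s) < W r₀ + η := fun s hs => by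
      rw [hm.energy_eq hξ hV isOpen_Ioo isPreconnected_Ioo hmom hs h0]
      exact hstart.2
    have hclose : |ρ t - r₀| < d := by
      by_contra hcon
      have hcont : ContinuousOn (fun s => |ρ s - r₀|) (Icc 0 t) := fun s hs =>
        ContinuousAt.continuousWithinAt
          (((hm s (hsub hs)).2.1.continuousAt.sub continuousAt_const).abs)
      -- Leaving the annulus would require crossing r₀ ± d, where the potential alone exceeds the
      -- available energy.
      obtain ⟨s, hs, hsd⟩ := intermediate_value_Icc ht.1 hcont
        (show d ∈ Icc |ρ 0 - r₀| |ρ t - r₀| from ⟨le_of_lt hstart.1, not_lt.1 hcon⟩)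
      have h1 := hE s (hsub hs)
      have h2 : min (W (r₀ - d)) (W (r₀ + d)) ≤ W (ρ s) := by
        rcases (abs_eq hd0.le).1 hsd with h | h
        · rw [show ρ s = r₀ + d by linarith]; exact min_le_right _ _
        · rw [show ρ s = r₀ - d by linarith]; exact min_le_left _ _
      have h3 : η ≤ min (W (r₀ - d)) (W (r₀ + d)) - W r₀ := min_le_left _ _
      nlinarith [sq_nonneg (deriv ρ s)]
    have hvel : |deriv ρ t| < δ := by
      have h1 := hE t htm
      have h2 := hWle (ρ t) (hm t htm).1
      have h3 : η ≤ δ ^ 2 / 2 := min_le_right _ _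
      exact abs_lt_of_sq_lt_sq (by linarith) hδ.le
    have := hUδ (ρ t) (deriv ρ t) (ψ t : Real.Angle) (hclose.trans hdδ) hvel
    rwa [phase, (hm.hasDerivAt_angle hξ hmom htm).deriv]

end Stability

/-! ### Explicit orbits and their closedness. -/

section Conic

variable {ξ : ℝ} {V : ℝ → ℝ}

/-- Solutions of `v' = i w θ'`, `w' = - i (v - v₀) θ'` are harmonic in `θ`. -/
theorem eq_harmonic {v w θ θ' : ℝ → ℝ} {k v₀ : ℝ}
    (hθ : ∀ t, HasDerivAt θ (θ' t) t) (hv : ∀ t, HasDerivAt v (k * w t * θ' t) t)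
    (hw : ∀ t, HasDerivAt w (-(k * (v t - v₀) * θ' t)) t) :
    ∃ P Q : ℝ, ∀ t, v t = v₀ + P * Real.cos (k * θ t) + Q * Real.sin (k * θ t) := by
  have hc : ∀ t, HasDerivAt (fun t => Real.cos (k * θ t)) (-Real.sin (k * θ t) * (k * θ' t)) t :=
    fun t => ((hθ t).const_mul k).cos
  have hs : ∀ t, HasDerivAt (fun t => Real.sin (k * θ t)) (Real.cos (k * θ t) * (k * θ' t)) t :=
    fun t => ((hθ t).const_mul k).sin
  -- Turning the vector (v − v₀, w) back by the angle kθ gives two constants of motion, which become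
  -- P and Q.
  have hP : ∀ t, HasDerivAt
      (fun t => (v t - v₀) * Real.cos (k * θ t) - w t * Real.sin (k * θ t)) 0 t := fun t => by
    refine ((((hv t).sub_const v₀).mul (hc t)).sub ((hw t).mul (hs t))).congr_deriv ?_
    ring
  have hQ : ∀ t, HasDerivAt
      (fun t => (v t - v₀) * Real.sin (k * θ t) + w t * Real.cos (k * θ t)) 0 t := fun t => by
    refine ((((hv t).sub_const v₀).mul (hs t)).add ((hw t).mul (hc t))).congr_deriv ?_
    ring
  refine ⟨(v 0 - v₀) * Real.cos (k * θ 0) - w 0 * Real.sin (k * θ 0),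
    (v 0 - v₀) * Real.sin (k * θ 0) + w 0 * Real.cos (k * θ 0), fun t => ?_⟩
  have h1 := is_const_of_deriv_eq_zero (fun x => (hP x).differentiableAt)
    (fun x => (hP x).deriv) t 0
  have h2 := is_const_of_deriv_eq_zero (fun x => (hQ x).differentiableAt)
    (fun x => (hQ x).deriv) t 0
  beta_reduce at h1 h2
  rw [← h1, ← h2]
  linear_combination (v₀ - v t) * Real.sin_sq_add_cos_sq (k * θ t)

/-- The orbits: `1 / rⁱ` is a harmonic function of `i ξ φ`. -/
theorem exists_conic (hξ : 0 < ξ) {i : ℕ} (hi : i = 1 ∨ i = 2)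
    {A : ℝ} (hG : ∀ x, 0 < x → circularMomentumSq V x = A * x ^ (i ^ 2)) {r φ : ℝ → ℝ} {K : ℝ}
    (h : IsNonsingularBounded (Ioi 0) (coneProfile ξ) V r φ K) :
    ∃ v₀ P Q : ℝ, ∀ t,
      (r t)⁻¹ ^ i = v₀ + P * Real.cos (i * (ξ * φ t)) + Q * Real.sin (i * (ξ * φ t)) := by
  obtain ⟨⟨hm, -⟩, hmom, hK0⟩ := h
  have hrpos : ∀ t, 0 < r t := fun t => (hm t (mem_univ _)).1
  have hrd : ∀ t, HasDerivAt r (deriv r t) t := fun t => (hm t (mem_univ _)).2.1.hasDerivAt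
  have hrd2 := fun t => hm.hasDerivAt_radialVelocity hξ hmom (mem_univ t)
  set L := K / ξ with hL
  have hL0 : L ≠ 0 := div_ne_zero hK0 hξ.ne'
  have hθ : ∀ t, HasDerivAt (fun t => ξ * φ t) (L / r t ^ 2) t := fun t => by
    refine ((hm.hasDerivAt_angle hξ hmom (mem_univ t)).const_mul ξ).congr_deriv ?_
    have := hrpos t
    rw [hL]
    field_simp
  rcases hi with rfl | rfl
  · refine ⟨A / L ^ 2, eq_harmonic (w := fun t => -(deriv r t / L)) hθ (fun t => ?_) fun t => ?_⟩
    · have := hrpos t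
      refine (((hrd t).inv this.ne').pow 1).congr_deriv ?_
      norm_num
      field_simp
    · have := hrpos t
      refine ((hrd2 t).div_const L).neg.congr_deriv ?_
      rw [hG _ this]
      norm_num
      field_simp
  -- For i = 2 the equation for r⁻² becomes linear only after eliminating the squared radial
  -- velocity by energy; E is twice the energy up to an additive constant.
  · obtain ⟨E, hE⟩ : ∃ E, ∀ t, deriv r t ^ 2 + L ^ 2 / r t ^ 2 + A * r t ^ 2 = E := by
      have hd : ∀ t, HasDerivAt
          (fun t => deriv r t ^ 2 + L ^ 2 / r t ^ 2 + A * r t ^ 2) 0 t := fun t => by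
        have := hrpos t
        refine ((((hrd2 t).pow 2).add ((hasDerivAt_const t (L ^ 2)).div ((hrd t).pow 2)
          (pow_ne_zero 2 this.ne'))).add (((hrd t).pow 2).const_mul A)).congr_deriv ?_
        rw [hG _ this]
        norm_num
        field_simp
        ring
      exact ⟨_, fun t => is_const_of_deriv_eq_zero (fun x => (hd x).differentiableAt)
        (fun x => (hd x).deriv) t 0⟩
    refine ⟨E / (2 * L ^ 2), eq_harmonic (w := fun t => -(deriv r t / (r t * L))) hθ
      (fun t => ?_) fun t => ?_⟩
    · have := hrpos t
      refine (((hrd t).inv this.ne').pow 2).congr_deriv ?_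
      norm_num
      field_simp
    · have := hrpos t
      refine ((hrd2 t).div ((hrd t).mul_const L) (mul_ne_zero this.ne' hL0)).neg.congr_deriv ?_
      rw [hG _ this, ← hE t]
      norm_num
      field_simp
      ring

/-- Periodicity tested at phase 0 and a quarter turn later gives (P² + Q²)(cos kT − 1) = 0, so kT is
a positive multiple of 2π. -/
theorem period_le_of_harmonic {k P Q T : ℝ} (hk : 0 < k) (hPQ : ¬ (P = 0 ∧ Q = 0)) (hT : 0 < T)
    (hper : ∀ θ, P * Real.cos (k * (θ + T)) + Q * Real.sin (k * (θ + T)) =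
      P * Real.cos (k * θ) + Q * Real.sin (k * θ)) : 2 * Real.pi / k ≤ T := by
  have h1 := hper 0
  have h2 := hper (Real.pi / 2 / k)
  rw [mul_add, mul_div_cancel₀ _ hk.ne', add_comm (Real.pi / 2), Real.cos_add_pi_div_two,
    Real.sin_add_pi_div_two] at h2
  simp only [zero_add, mul_zero, Real.cos_zero, Real.sin_zero, Real.cos_pi_div_two,
    Real.sin_pi_div_two, mul_one, add_zero] at h1 h2
  set c := Real.cos (k * T) with hc
  set s := Real.sin (k * T)
  have hcs : s ^ 2 + c ^ 2 = 1 := Real.sin_sq_add_cos_sq _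
  have h3 : (P ^ 2 + Q ^ 2) * (c - 1) = 0 := by linear_combination P * h1 + Q * h2
  have hPQ' : P ^ 2 + Q ^ 2 ≠ 0 := by
    intro h
    refine hPQ ⟨?_, ?_⟩ <;> nlinarith [sq_nonneg P, sq_nonneg Q]
  have h4 : c = 1 := by
    rcases mul_eq_zero.1 h3 with h | h
    · exact absurd h hPQ'
    · linarith
  obtain ⟨n, hn⟩ := (Real.cos_eq_one_iff _).1 h4
  have hkT : 0 < k * T := mul_pos hk hT
  have hn0 : 0 < n := by
    by_contra hcon
    have : (n : ℝ) ≤ 0 := by exact_mod_cast not_lt.1 hcon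
    nlinarith [Real.pi_pos]
  have hn1 : (1 : ℝ) ≤ n := by exact_mod_cast hn0
  rw [div_le_iff₀ hk, mul_comm T, ← hn]
  nlinarith [Real.pi_pos]

theorem surjective_of_deriv_ge {f f' : ℝ → ℝ} {m : ℝ} (hm : 0 < m)
    (hf : ∀ t, HasDerivAt f (f' t) t) (hf' : ∀ t, m ≤ f' t) : Function.Surjective f := by
  have hmono : Monotone fun t => f t - m * t := by
    refine monotone_of_deriv_nonneg (fun t => ?_) fun t => ?_
    · exact ((hf t).sub ((hasDerivAt_id t).const_mul m)).differentiableAt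
    · have h2 : deriv (fun t => f t - m * t) t = f' t - m * 1 :=
        ((hf t).sub ((hasDerivAt_id t).const_mul m)).deriv
      rw [h2]
      linarith [hf' t]
  have hc : Continuous f := continuous_iff_continuousAt.2 fun t => (hf t).continuousAt
  refine hc.surjective ?_ ?_
  · refine tendsto_atTop_mono' atTop ?_
      (tendsto_atTop_add_const_right atTop (f 0) (tendsto_id.const_mul_atTop hm))
    filter_upwards [eventually_ge_atTop 0] with x hx
    have := hmono hx
    simp only [id] at this ⊢
    linarith
  · refine tendsto_atBot_mono' atBot ?_
      (tendsto_atBot_add_const_right atBot (f 0) (tendsto_id.const_mul_atBot hm))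
    filter_upwards [eventually_le_atBot 0] with x hx
    have := hmono hx
    simp only [id] at this ⊢
    linarith

/-- Boundedness of the radius keeps the angular velocity K/(ξr)² of one sign and away from zero. -/
theorem surjective_angle (hξ : 0 < ξ) {r φ : ℝ → ℝ} {K : ℝ}
    (h : IsNonsingularBounded (Ioi 0) (coneProfile ξ) V r φ K) : Function.Surjective φ := by
  obtain ⟨⟨hm, r₁, r₂, -, hb⟩, hmom, hK0⟩ := h
  have hrpos : ∀ t, 0 < r t := fun t => (hm t (mem_univ _)).1
  have hφ := fun t => hm.hasDerivAt_angle hξ hmom (mem_univ t)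
  have hr₂ : 0 < r₂ := (hrpos 0).trans_le (hb 0).2
  have hle : ∀ t, (ξ * r t) ^ 2 ≤ (ξ * r₂) ^ 2 := fun t => by
    have := hrpos t
    have := (hb t).2
    gcongr
  have hpos : ∀ t, 0 < (ξ * r t) ^ 2 := fun t => by have := hrpos t; positivity
  rcases hK0.lt_or_gt with hK | hK
  · have hs : Function.Surjective fun t => -φ t :=
      surjective_of_deriv_ge (m := -K / (ξ * r₂) ^ 2)
        (div_pos (neg_pos.2 hK) (by positivity)) (fun t => (hφ t).neg) fun t => by
          rw [← neg_div]
          exact div_le_div_of_nonneg_left (neg_pos.2 hK).le (hpos t) (hle t)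
    intro y
    obtain ⟨t, ht⟩ := hs (-y)
    exact ⟨t, neg_injective ht⟩
  · exact surjective_of_deriv_ge (m := K / (ξ * r₂) ^ 2) (div_pos hK (by positivity)) hφ fun t =>
      div_le_div_of_nonneg_left hK.le (hpos t) (hle t)

/-- Take R = H^(−1/i), where H is the harmonic expression for r⁻ⁱ. Since the angle takes every real
value along the motion, H is positive everywhere. A noncircular orbit has nonzero harmonic part,
whose minimal period is 2π/(iξ). -/
theorem exists_graph (hξ : 0 < ξ) {i : ℕ} (hi : i = 1 ∨ i = 2)
    {A : ℝ} (hG : ∀ x, 0 < x → circularMomentumSq V x = A * x ^ (i ^ 2)) {r φ : ℝ → ℝ} {K : ℝ}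
    (h : IsNonsingularBounded (Ioi 0) (coneProfile ξ) V r φ K) :
    ∃ R : ℝ → ℝ, Continuous R ∧ (∀ θ, 0 < R θ) ∧ (∀ t, r t = R (φ t)) ∧
      Function.Periodic R (2 * Real.pi / (i * ξ)) ∧
      (¬ OrbitIsCircular r φ → ∀ T, 0 < T → Function.Periodic R T →
        2 * Real.pi / (i * ξ) ≤ T) := by
  obtain ⟨v₀, P, Q, hv⟩ := exists_conic hξ hi hG h
  have hsurj := surjective_angle hξ h
  have hrpos : ∀ t, 0 < r t := fun t => (h.1.1 t (mem_univ _)).1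
  have hi0 : i ≠ 0 := by rcases hi with rfl | rfl <;> norm_num
  have hiR : (0 : ℝ) < i := by positivity
  have hk : 0 < i * ξ := by positivity
  set H : ℝ → ℝ := fun θ => v₀ + P * Real.cos (i * (ξ * θ)) + Q * Real.sin (i * (ξ * θ)) with hH
  have hHc : Continuous H := by fun_prop
  have hHpos : ∀ θ, 0 < H θ := fun θ => by
    obtain ⟨t, rfl⟩ := hsurj θ
    have := hrpos t
    rw [show H (φ t) = (r t)⁻¹ ^ i from (hv t).symm]
    positivity
  set R : ℝ → ℝ := fun θ => (H θ)⁻¹ ^ ((i : ℝ)⁻¹) with hR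
  have hRpos : ∀ θ, 0 < R θ := fun θ => Real.rpow_pos_of_pos (inv_pos.2 (hHpos θ)) _
  have hRH : ∀ θ, (R θ)⁻¹ ^ i = H θ := fun θ => by
    rw [inv_pow, hR, Real.rpow_inv_natCast_pow (inv_pos.2 (hHpos θ)).le hi0, inv_inv]
  refine ⟨R, ?_, hRpos, fun t => ?_, ?_, ?_⟩
  · exact (hHc.inv₀ fun θ => (hHpos θ).ne').rpow_const fun θ => Or.inl (inv_pos.2 (hHpos θ)).ne'
  · have h1 : H (φ t) = (r t)⁻¹ ^ i := (hv t).symm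
    simp only [hR]
    rw [h1, inv_pow, inv_inv, Real.pow_rpow_inv_natCast (hrpos t).le hi0]
  · intro θ
    have h1 : H (θ + 2 * Real.pi / (i * ξ)) = H θ := by
      have : i * (ξ * (θ + 2 * Real.pi / (i * ξ))) = i * (ξ * θ) + 2 * Real.pi := by
        field_simp
      simp only [hH]
      rw [this, Real.cos_add_two_pi, Real.sin_add_two_pi]
    simp only [hR, h1]
  · intro hnc T hT hper
    refine period_le_of_harmonic (P := P) (Q := Q) hk ?_ hT fun θ => ?_
    · rintro ⟨rfl, rfl⟩
      have hconst : ∀ t, r t = r 0 := fun t => by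
        have h1 : (r t)⁻¹ ^ i = (r 0)⁻¹ ^ i := by rw [hv t, hv 0]; simp
        exact inv_injective
          ((pow_left_inj₀ (inv_pos.2 (hrpos t)).le (inv_pos.2 (hrpos 0)).le hi0).1 h1)
      exact hnc ⟨r 0, orbitIsCircle_of_eq_const rfl h.1.1 h.2.1 h.2.2 hconst⟩
    · have h1 : H (θ + T) = H θ := by rw [← hRH, ← hRH, hper θ]
      simp only [hH] at h1
      simp only [mul_assoc]
      linarith

theorem orbitIsPeriodicGraph (hξ : 0 < ξ) {i : ℕ}
    (hi : i = 1 ∨ i = 2) {A : ℝ}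
    (hG : ∀ x, 0 < x → circularMomentumSq V x = A * x ^ (i ^ 2)) {r φ : ℝ → ℝ} {K : ℝ}
    (h : IsNonsingularBounded (Ioi 0) (coneProfile ξ) V r φ K) (hnc : ¬ OrbitIsCircular r φ) :
    OrbitIsPeriodicGraph r φ (2 * Real.pi / (i * ξ)) := by
  obtain ⟨R, -, -, hR, hper, hmin⟩ := exists_graph hξ hi hG h
  have hi0 : (0 : ℝ) < i := by rcases hi with rfl | rfl <;> norm_num
  refine ⟨R, hR, ?_, ⟨by positivity, hper⟩, fun T hT => hmin hnc T hT.1 hT.2⟩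
  have : orbit r φ = range ((fun θ : ℝ => (R θ, (θ : Real.Angle))) ∘ φ) := by
    simp only [orbit, hR]
    rfl
  rw [this, (surjective_angle hξ h).range_comp]

/-- For rational ξ, a multiple X of the period 2π/(iξ) is also a multiple of 2π. The integral F of
R² along the angle grows linearly in time at rate K/ξ², so the time needed for the angle to change
by ±X is the same from every starting point. -/
theorem orbitIsClosed_of_not_irrational (hξ : 0 < ξ) (hrat : ¬ Irrational ξ) {i : ℕ}
    (hi : i = 1 ∨ i = 2) {A : ℝ}
    (hG : ∀ x, 0 < x → circularMomentumSq V x = A * x ^ (i ^ 2)) {r φ : ℝ → ℝ} {K : ℝ}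
    (h : IsNonsingularBounded (Ioi 0) (coneProfile ξ) V r φ K) : OrbitIsClosed r φ := by
  obtain ⟨R, hRc, hRpos, hR, hper, -⟩ := exists_graph hξ hi hG h
  obtain ⟨⟨hm, -⟩, hmom, hK0⟩ := h
  have hi0 : (i : ℝ) ≠ 0 := by rcases hi with rfl | rfl <;> norm_num
  obtain ⟨q, rfl⟩ : ∃ q : ℚ, (q : ℝ) = ξ := not_not.1 hrat
  have hq : 0 < q := by exact_mod_cast hξ
  -- For ξ = p/d in lowest terms, X = 2πd is ip times the period 2π/(iξ).
  set X := 2 * Real.pi * q.den with hX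
  have hX0 : 0 < X := by have := q.pos; positivity
  have hRX : Function.Periodic R X := by
    have h1 := hper.nat_mul (i * q.num.toNat)
    have h2 : ((i * q.num.toNat : ℕ) : ℝ) * (2 * Real.pi / (i * q)) = X := by
      have h3 : ((q.num.toNat : ℕ) : ℝ) = q * q.den := by
        have h4 : ((q.num.toNat : ℕ) : ℤ) = q.num := Int.toNat_of_nonneg (Rat.num_pos.2 hq).le
        have h5 : (q : ℝ) * q.den = q.num := by exact_mod_cast Rat.mul_den_eq_num q
        rw [h5, ← h4]
        push_cast
        rfl
      push_cast
      rw [h3, hX]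
      field_simp
    rwa [h2] at h1
  have hR2 : Continuous fun θ => R θ ^ 2 := hRc.pow 2
  set F : ℝ → ℝ := fun x => ∫ y in (0 : ℝ)..x, R y ^ 2 with hF
  have hFd : ∀ x, HasDerivAt F (R x ^ 2) x := fun x =>
    intervalIntegral.integral_hasDerivAt_right (hR2.intervalIntegrable _ _)
      (hR2.stronglyMeasurableAtFilter _ _) hR2.continuousAt
  have hFmono : StrictMono F := strictMono_of_deriv_pos fun x => by
    rw [(hFd x).deriv]
    have := hRpos x
    positivity
  have hFX : ∀ x, F (x + X) = F x + F X := fun x => by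
    have hp : Function.Periodic (fun θ => R θ ^ 2) X := fun θ => by simp only [hRX θ]
    have h1 := hp.intervalIntegral_add_eq x 0
    rw [zero_add] at h1
    have h2 := intervalIntegral.integral_add_adjacent_intervals
      (hR2.intervalIntegrable (μ := MeasureTheory.volume) 0 x) (hR2.intervalIntegrable x (x + X))
    simp only [hF]
    rw [← h2, h1]
  have hF0 : 0 < F X := by
    have := hFmono hX0
    simpa [hF] using this
  have hlin : ∀ t, F (φ t) - K / q ^ 2 * t = F (φ 0) := fun t => by
    have hd : ∀ t, HasDerivAt (fun t => F (φ t) - K / (q : ℝ) ^ 2 * t) 0 t := fun t => by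
      refine (((hFd (φ t)).comp t (hm.hasDerivAt_angle hξ hmom (mem_univ t))).sub
        ((hasDerivAt_id t).const_mul (K / (q : ℝ) ^ 2))).congr_deriv ?_
      have := hRpos (φ t)
      rw [hR]
      field_simp
      simp
    have := is_const_of_deriv_eq_zero (fun x => (hd x).differentiableAt)
      (fun x => (hd x).deriv) t 0
    simpa using this
  have hangle : ∀ x : ℝ, ((x + X : ℝ) : Real.Angle) = x := fun x => by
    rw [Real.Angle.angle_eq_iff_two_pi_dvd_sub]
    exact ⟨q.den, by rw [hX]; push_cast; ring⟩
  set T := (q : ℝ) ^ 2 * F X / |K| with hT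
  have hT0 : 0 < T := by have := abs_pos.2 hK0; positivity
  refine ⟨T, hT0, fun t => ?_⟩
  have h1 := hlin t
  have h2 := hlin (t + T)
  rcases hK0.lt_or_gt with hK | hK
  · have h3 : K / q ^ 2 * T = -F X := by
      rw [hT, abs_of_neg hK]
      have := hK.ne
      field_simp
    have h4 : φ (t + T) + X = φ t := hFmono.injective (by rw [hFX]; linarith)
    rw [hR, hR (t := t), ← h4, hRX, hangle]
    exact ⟨rfl, rfl⟩
  · have h3 : K / q ^ 2 * T = F X := by
      rw [hT, abs_of_pos hK]
      field_simp
    have h4 : φ (t + T) = φ t + X := hFmono.injective (by rw [hFX]; linarith)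
    rw [hR, hR (t := t), h4, hRX, hangle]
    exact ⟨rfl, rfl⟩

end Conic

end Revolution

namespace Revolution

/-! ### The classification -/

section Classification

variable {ξ : ℝ} {V : ℝ → ℝ}

theorem exists_momentum (hξ : 0 < ξ) {r₀ : ℝ} (hG : 0 < circularMomentumSq V r₀) :
    ∃ K, K ≠ 0 ∧ (K / ξ) ^ 2 = circularMomentumSq V r₀ :=
  ⟨ξ * √(circularMomentumSq V r₀), (mul_pos hξ (Real.sqrt_pos.2 hG)).ne', by
    rw [mul_div_cancel_left₀ _ hξ.ne', Real.sq_sqrt hG.le]⟩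

theorem StronglyStableNearbyClosed.isConePotential (hξ : 0 < ξ) (hV : ContDiffOn ℝ ∞ V (Ioi 0))
    (h : StronglyStableNearbyClosed (Ioi 0) (coneProfile ξ) V)
    (hex : ∃ r₀, 0 < r₀ ∧ 0 < circularMomentumSq V r₀ ∧ 0 < deriv (circularMomentumSq V) r₀) :
    ¬ Irrational ξ ∧ IsConePotential V :=
  isConePotential_of_nearbyOrbitsClosed hξ hV hex fun r₀ hr₀ hG hG' => by
    obtain ⟨K, hK0, hK⟩ := exists_momentum hξ hG
    exact ⟨K, hK0, hK, h r₀ K ((isStronglyStable_iff hξ hV).2 ⟨hr₀, hK0, hK, hG'⟩)⟩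

theorem IsStronglyStable.exists_pos (hξ : 0 < ξ) (hV : ContDiffOn ℝ ∞ V (Ioi 0)) {r₀ K : ℝ}
    (h : IsStronglyStable (Ioi 0) (coneProfile ξ) V r₀ K) :
    ∃ r₀, 0 < r₀ ∧ 0 < circularMomentumSq V r₀ ∧ 0 < deriv (circularMomentumSq V) r₀ := by
  obtain ⟨h1, h2, h3, h4⟩ := (isStronglyStable_iff hξ hV).1 h
  refine ⟨r₀, h1, ?_, h4⟩
  rw [← h3]
  have := div_ne_zero h2 hξ.ne'
  positivity

theorem IsLocallyClosing.isConePotential (hξ : 0 < ξ) (hV : ContDiffOn ℝ ∞ V (Ioi 0))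
    (h : IsLocallyClosing (Ioi 0) (coneProfile ξ) V) : ¬ Irrational ξ ∧ IsConePotential V := by
  obtain ⟨⟨r₀, K, hs⟩, h2⟩ := h
  exact h2.isConePotential hξ hV (hs.exists_pos hξ hV)

theorem IsStronglyClosing.isConePotential (hξ : 0 < ξ) (hV : ContDiffOn ℝ ∞ V (Ioi 0))
    (h : IsStronglyClosing (Ioi 0) (coneProfile ξ) V) : ¬ Irrational ξ ∧ IsConePotential V := by
  obtain ⟨K, hs⟩ := h.1 1 (mem_Ioi.2 zero_lt_one)
  exact h.2.isConePotential hξ hV (hs.exists_pos hξ hV)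

theorem IsSemilocallyClosing.isConePotential (hξ : 0 < ξ) (hV : ContDiffOn ℝ ∞ V (Ioi 0))
    (h : IsSemilocallyClosing (Ioi 0) (coneProfile ξ) V) :
    ¬ Irrational ξ ∧ IsConePotential V := by
  obtain ⟨⟨r, φ, K, hb, hnc, hcl⟩, h2⟩ := h
  refine h2.isConePotential hξ hV (exists_stable_of_closed_noncircular hξ hV hb hnc ?_)
  obtain ⟨⟨-, r₁, r₂, -, hr⟩, -⟩ := id hb
  -- The orbit γ lies in its own annulus, so it is itself closed.
  exact hcl r φ hb fun t =>
    ⟨csInf_le ⟨r₁, by rintro _ ⟨s, rfl⟩; exact (hr s).1⟩ (mem_range_self t),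
      le_csSup ⟨r₂, by rintro _ ⟨s, rfl⟩; exact (hr s).2⟩ (mem_range_self t)⟩

theorem nearbyOrbitsClosed_of_forall {I : Set ℝ} {f : ℝ → ℝ}
    (h : ∀ r φ K, IsNonsingularBounded I f V r φ K → OrbitIsClosed r φ) (r₀ K₀ : ℝ) :
    NearbyOrbitsClosed I f V r₀ K₀ :=
  ⟨1, one_pos, fun r φ K hb _ _ => h r φ K hb⟩

theorem IsClosing.isConePotential (hξ : 0 < ξ) (hV : ContDiffOn ℝ ∞ V (Ioi 0))
    (h : IsClosing (Ioi 0) (coneProfile ξ) V) : ¬ Irrational ξ ∧ IsConePotential V := by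
  obtain ⟨⟨r, φ, K, hb, hnc⟩, hall⟩ := h
  exact IsSemilocallyClosing.isConePotential hξ hV
    ⟨⟨r, φ, K, hb, hnc, fun ρ ψ hρ _ => hall ρ ψ K hρ⟩,
      fun r₀ K₀ _ => nearbyOrbitsClosed_of_forall hall r₀ K₀⟩

theorem IsWeaklyClosing.isConePotential (hξ : 0 < ξ) (hV : ContDiffOn ℝ ∞ V (Ioi 0))
    (h : IsWeaklyClosing (Ioi 0) (coneProfile ξ) V) : ¬ Irrational ξ ∧ IsConePotential V := by
  refine isConePotential_of_nearbyOrbitsClosed hξ hV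
    (exists_stable_of_orbitallyStable hξ hV h.1) fun r₀ hr₀ _ _ => ?_
  obtain ⟨K, hK⟩ := h.1 r₀ hr₀
  obtain ⟨r, φ, hc, -⟩ := id hK
  obtain ⟨-, h1, h2⟩ := hc.pos_and_momentum hξ
  exact ⟨K, h1, h2, h.2 r₀ K hK⟩

theorem circularMomentumSq_of_eq_conePotential {i : ℕ} (hi : i = 1 ∨ i = 2) {A B : ℝ}
    (hVA : ∀ r, 0 < r → V r = conePotential i A B r) {x : ℝ} (hx : 0 < x) :
    circularMomentumSq V x = A * x ^ (i ^ 2) := by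
  have h1 : HasDerivAt V (A * x ^ (i ^ 2) / x ^ 3) x := by
    refine (hasDerivAt_conePotential hi A B hx).congr_of_eventuallyEq ?_
    filter_upwards [Ioi_mem_nhds hx] with y hy using hVA y hy
  rw [circularMomentumSq, h1.deriv]
  field_simp

/-- If `ξ` is rational, Newton's and Hooke's potentials are closing in all five senses. -/
theorem IsConePotential.closing (hξ : 0 < ξ) (hrat : ¬ Irrational ξ)
    (hV : ContDiffOn ℝ ∞ V (Ioi 0)) (h : IsConePotential V) :
    IsClosing (Ioi 0) (coneProfile ξ) V ∧ IsLocallyClosing (Ioi 0) (coneProfile ξ) V ∧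
      IsSemilocallyClosing (Ioi 0) (coneProfile ξ) V ∧
      IsStronglyClosing (Ioi 0) (coneProfile ξ) V ∧ IsWeaklyClosing (Ioi 0) (coneProfile ξ) V := by
  obtain ⟨i, hi, A, B, hA, hVA⟩ := h
  have hG : ∀ x, 0 < x → circularMomentumSq V x = A * x ^ (i ^ 2) := fun x hx =>
    circularMomentumSq_of_eq_conePotential hi hVA hx
  have hi0 : i ^ 2 ≠ 0 := by rcases hi with rfl | rfl <;> norm_num
  have hGpos : ∀ x, 0 < x → 0 < circularMomentumSq V x := fun x hx => by
    rw [hG x hx]; positivity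
  have hG'pos : ∀ x, 0 < x → 0 < deriv (circularMomentumSq V) x := fun x hx => by
    have h1 : HasDerivAt (circularMomentumSq V) (A * ((i ^ 2 : ℕ) * x ^ (i ^ 2 - 1))) x := by
      refine ((hasDerivAt_pow (i ^ 2) x).const_mul A).congr_of_eventuallyEq ?_
      filter_upwards [Ioi_mem_nhds hx] with y hy using hG y hy
    rw [h1.deriv]
    have : 0 < ((i ^ 2 : ℕ) : ℝ) := by exact_mod_cast Nat.pos_of_ne_zero hi0
    positivity
  have hmono : StrictMonoOn (circularMomentumSq V) (Ioi 0) := fun x hx y hy hxy => by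
    rw [hG x hx, hG y hy]
    exact mul_lt_mul_of_pos_left (pow_lt_pow_left₀ hxy (le_of_lt hx) hi0) hA
  have hall : ∀ r φ K, IsNonsingularBounded (Ioi 0) (coneProfile ξ) V r φ K →
      OrbitIsClosed r φ := fun r φ K hb => orbitIsClosed_of_not_irrational hξ hrat hi hG hb
  have hnear := nearbyOrbitsClosed_of_forall hall
  have hstable : ∀ r₀ ∈ Ioi (0 : ℝ), ∃ K, IsStronglyStable (Ioi 0) (coneProfile ξ) V r₀ K := by
    intro r₀ hr₀
    obtain ⟨K, hK0, hK⟩ := exists_momentum hξ (hGpos r₀ hr₀)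
    exact ⟨K, (isStronglyStable_iff hξ hV).2 ⟨hr₀, hK0, hK, hG'pos r₀ hr₀⟩⟩
  obtain ⟨K, hK0, hK⟩ := exists_momentum hξ (hGpos 1 one_pos)
  obtain ⟨r, φ, hb, -, hnc⟩ := exists_noncircular hξ hV one_pos hK0 hK (hG'pos 1 one_pos)
    univ_mem
  obtain ⟨K₁, hK₁⟩ := hstable 1 (mem_Ioi.2 zero_lt_one)
  refine ⟨⟨⟨r, φ, K, hb, hnc⟩, hall⟩, ⟨⟨1, K₁, hK₁⟩, fun r₀ K₀ _ => hnear r₀ K₀⟩,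
    ⟨⟨r, φ, K, hb, hnc, fun ρ ψ hρ _ => hall ρ ψ K hρ⟩, fun r₀ K₀ _ => hnear r₀ K₀⟩,
    ⟨hstable, fun r₀ K₀ _ => hnear r₀ K₀⟩, fun r₀ hr₀ => ?_, fun r₀ K₀ _ => hnear r₀ K₀⟩
  obtain ⟨K₂, hK₂0, hK₂⟩ := exists_momentum hξ (hGpos r₀ hr₀)
  exact ⟨K₂, isOrbitallyStable_of_strictMonoOn hξ hV hr₀ hK₂0 hK₂ hmono⟩

theorem contDiffOn_conePotential {i : ℕ} (hi : i = 1 ∨ i = 2) (A B : ℝ) :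
    ContDiffOn ℝ ∞ (conePotential i A B) (Ioi 0) := by
  rcases hi with rfl | rfl
  · rw [funext (conePotential_one A B)]
    exact (contDiffOn_const.div contDiffOn_id fun x hx => (mem_Ioi.1 hx).ne').add contDiffOn_const
  · rw [funext (conePotential_two A B)]
    fun_prop

/-- The derivative is positive, and a nondecreasing function tends to its infimum at the left end;
in `EReal` this also covers the value −∞. -/
theorem isAttractingCenter_conePotential {i : ℕ} (hi : i = 1 ∨ i = 2) {A : ℝ} (hA : 0 < A)
    (B : ℝ) : IsAttractingCenter (Ioi 0) (conePotential i A B) 0 := by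
  have hmono : MonotoneOn (fun r => (conePotential i A B r : EReal)) (Ioi 0) := by
    have h1 : MonotoneOn (conePotential i A B) (Ioi 0) := by
      refine monotoneOn_of_deriv_nonneg (convex_Ioi 0)
        (contDiffOn_conePotential hi A B).continuousOn (fun x hx => ?_) fun x hx => ?_
      all_goals
        rw [interior_Ioi] at hx
        have hx : 0 < x := hx
      · exact (hasDerivAt_conePotential hi A B hx).differentiableAt.differentiableWithinAt
      · rw [(hasDerivAt_conePotential hi A B hx).deriv]
        positivity
    exact fun x hx y hy hxy => EReal.coe_le_coe_iff.2 (h1 hx hy hxy)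
  have := hmono.tendsto_nhdsGT (OrderBot.bddBelow _)
  rwa [sInf_image] at this

/-- The functions 1, 1/r and r² are already linearly independent on the three points 1, 2 and 4. -/
theorem conePotential_one_ne {A₁ B₁ A₂ B₂ : ℝ} (hA₁ : 0 < A₁) :
    ¬ ∃ a b : ℝ, ∀ r : ℝ, 0 < r →
      conePotential 1 A₁ B₁ r = a * conePotential 2 A₂ B₂ r + b := by
  rintro ⟨a, b, h⟩
  have h1 := h 1 one_pos
  have h2 := h 2 two_pos
  have h4 := h 4 four_pos
  rw [conePotential_one, conePotential_two] at h1 h2 h4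
  linarith

end Classification

end Revolution

theorem mainTheorem5 (ξ : ℝ) (hξ : 0 < ξ) :
    (Irrational ξ →
      ∀ V : ℝ → ℝ, ContDiffOn ℝ ∞ V (Ioi 0) →
        ¬ Revolution.IsClosing (Ioi 0) (Revolution.coneProfile ξ) V ∧
        ¬ Revolution.IsLocallyClosing (Ioi 0) (Revolution.coneProfile ξ) V ∧
        ¬ Revolution.IsSemilocallyClosing (Ioi 0) (Revolution.coneProfile ξ) V ∧
        ¬ Revolution.IsStronglyClosing (Ioi 0) (Revolution.coneProfile ξ) V ∧
        ¬ Revolution.IsWeaklyClosing (Ioi 0) (Revolution.coneProfile ξ) V) ∧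
    (¬ Irrational ξ →
      -- in each of the five senses, the closing potentials are exactly the two families
      (∀ V : ℝ → ℝ, ContDiffOn ℝ ∞ V (Ioi 0) →
        (Revolution.IsClosing (Ioi 0) (Revolution.coneProfile ξ) V ↔
          Revolution.IsConePotential V) ∧
        (Revolution.IsLocallyClosing (Ioi 0) (Revolution.coneProfile ξ) V ↔
          Revolution.IsConePotential V) ∧
        (Revolution.IsSemilocallyClosing (Ioi 0) (Revolution.coneProfile ξ) V ↔
          Revolution.IsConePotential V) ∧
        (Revolution.IsStronglyClosing (Ioi 0) (Revolution.coneProfile ξ) V ↔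
          Revolution.IsConePotential V) ∧
        (Revolution.IsWeaklyClosing (Ioi 0) (Revolution.coneProfile ξ) V ↔
          Revolution.IsConePotential V)) ∧
      -- both families consist of smooth potentials
      (∀ (i : ℕ) (A B : ℝ), (i = 1 ∨ i = 2) → 0 < A →
        ContDiffOn ℝ ∞ (Revolution.conePotential i A B) (Ioi 0)) ∧
      -- the two families differ, up to additive and multiplicative constants
      (∀ A₁ B₁ A₂ B₂ : ℝ, 0 < A₁ → 0 < A₂ →
        ¬ ∃ a b : ℝ, ∀ r : ℝ, 0 < r →
          Revolution.conePotential 1 A₁ B₁ r = a * Revolution.conePotential 2 A₂ B₂ r + b) ∧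
      -- the nonsingular noncircular bounded orbits
      (∀ (i : ℕ) (A B : ℝ), (i = 1 ∨ i = 2) → 0 < A →
        ∀ (r φ : ℝ → ℝ) (K : ℝ),
          Revolution.IsNonsingularBounded (Ioi 0) (Revolution.coneProfile ξ)
            (Revolution.conePotential i A B) r φ K →
          ¬ Revolution.OrbitIsCircular r φ →
          Revolution.OrbitIsPeriodicGraph r φ (2 * Real.pi / (i * ξ))) ∧
      -- the vertex is an attracting center
      (∀ (i : ℕ) (A B : ℝ), (i = 1 ∨ i = 2) → 0 < A →
        Revolution.IsAttractingCenter (Ioi 0) (Revolution.conePotential i A B) 0)) := by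
  constructor
  · intro hirr V hV
    exact ⟨fun h => (h.isConePotential hξ hV).1 hirr, fun h => (h.isConePotential hξ hV).1 hirr,
      fun h => (h.isConePotential hξ hV).1 hirr, fun h => (h.isConePotential hξ hV).1 hirr,
      fun h => (h.isConePotential hξ hV).1 hirr⟩
  · intro hrat
    refine ⟨fun V hV => ?_, fun i A B hi _ => Revolution.contDiffOn_conePotential hi A B,
      fun A₁ B₁ A₂ B₂ hA₁ _ => Revolution.conePotential_one_ne hA₁,
      fun i A B hi _ r φ K hb hnc => ?_,
      fun i A B hi hA => Revolution.isAttractingCenter_conePotential hi hA B⟩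
    · exact ⟨⟨fun h => (h.isConePotential hξ hV).2, fun h => (h.closing hξ hrat hV).1⟩,
        ⟨fun h => (h.isConePotential hξ hV).2, fun h => (h.closing hξ hrat hV).2.1⟩,
        ⟨fun h => (h.isConePotential hξ hV).2, fun h => (h.closing hξ hrat hV).2.2.1⟩,
        ⟨fun h => (h.isConePotential hξ hV).2, fun h => (h.closing hξ hrat hV).2.2.2.1⟩,
        ⟨fun h => (h.isConePotential hξ hV).2, fun h => (h.closing hξ hrat hV).2.2.2.2⟩⟩
    · exact Revolution.orbitIsPeriodicGraph hξ hi
        (fun x hx => Revolution.circularMomentumSq_of_eq_conePotential hi (fun _ _ => rfl) hx) hb hnc
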